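/- Let $k$ be a commutative artinian ring, let $\check k$ be the minimal injective cogenerator of the category $k\text{-mod}$ of finitely generated $k$-modules, and put $D=\operatorname{Hom}_k(-,\check k)$. Let $n\ge 1$ and let $(\mathcal C,\mathbb E,\mathfrak s)$ be a $k$-linear $n$-exangulated category in the sense of Herschend–Liu–Nakaoka ($\mathcal C$ additive and $k$-linear, $\mathbb E:\mathcal C^{op}\times\mathcal C\to k\text{-Mod}$ a $k$-bilinear functor, $\mathfrak s$ an exact realization satisfying (EA1), (EA2), (EA2$^{op}$)). Assume that it is Ext-finite (every $\mathbb E(X,Y)$ is a finitely generated $k$-module), that $\mathcal C$ is Krull–Schmidt (every object is a finite direct sum of objects with local endomorphism rings), and that for all composable $f,g$: if $g\circ f$ is a deflation, so is $g$; if $g\circ f$ is an inflation, so is $f$. Notation. A morphism $f:X\to Y$ is $n$-projectively trivial if $\mathbb E(f,Z)=0$ for all $Z$, and $n$-injectively trivial if $\mathbb E(Z,f)=0$ for all $Z$; $\mathcal P(X,Y)\subseteq\mathcal C(X,Y)$ is the set of $n$-projectively trivial morphisms, and $\overline{\mathcal C}$ is the category with the objects of $\mathcal C$ and morphisms taken modulo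 $n$-injectively trivial ones. $\mathcal C_r$ is the class of objects $X$ such that the contravariant functor $D\mathbb E(X,-)$ on $\overline{\mathcal C}$ is representable. An object $P$ is projective if every morphism from $P$ to the last term of a distinguished $n$-exangle factors through its last map. A morphism $f:X\to Y$ is right $K$-determined if every $g:L\to Y$ such that $g\circ h$ factors through $f$ for all $h:K\to L$ itself factors through $f$; left $K$-determined is the dual notion. A morphism $g:Z\to Y$ almost factors through $f:X\to Y$ if $g$ does not factor through $f$ but $g\circ h$ does for every $T$ and every $h\in\operatorname{rad}_{\mathcal C}(T,Z)$. An Auslander–Reiten $n$-exangle is a distinguished $n$-exangle $A_0\xrightarrow{\alpha_0}A_1\to\cdots\to A_n\xrightarrow{\alpha_n}A_{n+1}\dashrightarrow$ with $\alpha_0$ left almost split, $\alpha_n$ right almost split and $\alpha_1,\dots,\alpha_{n-1}\in\operatorname{rad}_{\mathcal C}$; it ends at $A_{n+1}$. An object $W$ is the intrinsic weak $n$-cokernel of an inflation $f:X_0\to X_1$ if there is a distinguished $n$-exangle $X_0\xrightarrow{f'}Z_1\xrightarrow{d_1}\cdots\xrightarrow{d_{n-1}}Z_n\xrightarrow{d_n}W\dashrightarrow$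 such that $f'$ is left minimal, $f$ and $f'$ factor through each other, and $d_1,\dots,d_n\in\operatorname{rad}_{\mathcal C}$. Theorem. Let $C\in\mathcal C$. The following are equivalent. (1) $C\in\mathcal C_r$. (2) For every $X_{n+1}\in\mathcal C$ and every right $\operatorname{End}_{\mathcal C}(C)$-submodule $H$ of $\mathcal C(C,X_{n+1})$ with $\mathcal P(C,X_{n+1})\subseteq H$, there is a distinguished $n$-exangle $X_0\to X_1\to\cdots\to X_n\xrightarrow{\alpha}X_{n+1}\overset{\eta}{\dashrightarrow}$ such that $\alpha$ is right $C$-determined and $H=\operatorname{Im}\mathcal C(C,\alpha)$. If moreover $C$ is non-projective and indecomposable, then (1) and (2) are also equivalent to each of the following. (3) There is an inflation $\alpha:X_0\to X_1$ whose intrinsic weak $n$-cokernel is $C$ and which is left $K$-determined for some object $K$. (4) There is an Auslander–Reiten $n$-exangle ending at $C$. (5) There is a deflation which is not a split epimorphism and is right $C$-determined. (6) There are a deflation $\alpha:X_n\to X_{n+1}$ and a morphism $f:C\to X_{n+1}$ such that $f$ almost factors through $\alpha$. -/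

import Mathlib

open CategoryTheory CategoryTheory.Limits Opposite

universe w v u uk

namespace NExang

noncomputable section

instance hasBinaryBiproducts (C : Type u) [Category.{v} C] [HasZeroMorphisms C]
    [HasFiniteBiproducts C] : HasBinaryBiproducts C :=
  hasBinaryBiproducts_of_finite_biproducts C

/-! ## Morphisms in a preadditive category -/

section Morphisms

variable {C : Type u} [Category.{v} C]

/-- `f : X ⟶ Y` lies in the Jacobson radical of `C`: `1 - f g` is invertible for every `g : Y ⟶ X`.
For `X = Y` this is the Jacobson radical of the endomorphism ring. -/
def InRadical [Preadditive C] {X Y : C} (f : X ⟶ Y) : Prop :=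
  ∀ g : Y ⟶ X, IsIso (𝟙 X - f ≫ g)

/-- `g` factors through `f` (both with the same target). -/
def FactorsThrough {X Y L : C} (g : L ⟶ Y) (f : X ⟶ Y) : Prop :=
  ∃ s : L ⟶ X, s ≫ f = g

/-- `g` factors through `f` (both with the same source). -/
def CofactorsThrough {X Y L : C} (g : X ⟶ L) (f : X ⟶ Y) : Prop :=
  ∃ s : Y ⟶ L, f ≫ s = g

/-- `f` is right almost split. -/
def RightAlmostSplit {X Y : C} (f : X ⟶ Y) : Prop :=
  ¬ IsSplitEpi f ∧ ∀ ⦃L : C⦄ (g : L ⟶ Y), ¬ IsSplitEpi g → FactorsThrough g f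

/-- `f` is left almost split. -/
def LeftAlmostSplit {X Y : C} (f : X ⟶ Y) : Prop :=
  ¬ IsSplitMono f ∧ ∀ ⦃L : C⦄ (g : X ⟶ L), ¬ IsSplitMono g → CofactorsThrough g f

/-- `f` is right `K`-determined. -/
def RightDetermined (K : C) {X Y : C} (f : X ⟶ Y) : Prop :=
  ∀ ⦃L : C⦄ (g : L ⟶ Y), (∀ h : K ⟶ L, FactorsThrough (h ≫ g) f) → FactorsThrough g f

/-- `f` is left `K`-determined. -/
def LeftDetermined (K : C) {X Y : C} (f : X ⟶ Y) : Prop :=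
  ∀ ⦃L : C⦄ (g : X ⟶ L), (∀ h : L ⟶ K, CofactorsThrough (g ≫ h) f) → CofactorsThrough g f

/-- `g : Z ⟶ Y` almost factors through `f : X ⟶ Y`. -/
def AlmostFactorsThrough [Preadditive C] {X Y Z : C} (g : Z ⟶ Y) (f : X ⟶ Y) : Prop :=
  ¬ FactorsThrough g f ∧ ∀ ⦃T : C⦄ (h : T ⟶ Z), InRadical h → FactorsThrough (h ≫ g) f

/-- `f` is left minimal. -/
def LeftMinimal {X Y : C} (f : X ⟶ Y) : Prop :=
  ∀ φ : Y ⟶ Y, f ≫ φ = f → IsIso φ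

/-- `f` and `f'`, with the same source, are left equivalent: each factors through the other. -/
def LeftEquivalent {X Y Y' : C} (f : X ⟶ Y) (f' : X ⟶ Y') : Prop :=
  CofactorsThrough f f' ∧ CofactorsThrough f' f

variable (C) in
/-- `C` is Krull–Schmidt: every object is a finite direct sum of objects with local
endomorphism rings. -/
def KrullSchmidt [Preadditive C] [HasFiniteBiproducts C] : Prop :=
  ∀ X : C, ∃ (m : ℕ) (Y : Fin m → C),
    (∀ i, IsLocalRing (End (Y i))) ∧ Nonempty (X ≅ ⨁ Y)

end Morphisms

/-! ## The minimal injective cogenerator and the duality -/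

section Duality

/-- `Q` is an injective cogenerator of the category of finitely generated `k`-modules. -/
structure IsInjectiveCogenerator (k : Type uk) [CommRing k]
    (Q : Type uk) [AddCommGroup Q] [Module k Q] : Prop where
  finite : Module.Finite k Q
  injective : Module.Injective k Q
  cogenerates : ∀ (M : Type uk) [AddCommGroup M] [Module k M] [Module.Finite k M] (m : M),
    m ≠ 0 → ∃ φ : M →ₗ[k] Q, φ m ≠ 0

/-- `Q` is a minimal injective cogenerator of the category of finitely generated `k`-modules: no
proper submodule of `Q` is an injective cogenerator. -/
structure IsMinimalInjectiveCogenerator (k : Type uk) [CommRing k]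
    (Q : Type uk) [AddCommGroup Q] [Module k Q] : Prop extends IsInjectiveCogenerator k Q where
  minimal : ∀ N : Submodule k Q, IsInjectiveCogenerator k N → N = ⊤

variable (k : Type uk) [CommRing k] (Q : Type uk) [AddCommGroup Q] [Module k Q]

/-- The functor `D = Hom_k(-, Q)`. -/
def dual : (ModuleCat.{w} k)ᵒᵖ ⥤ ModuleCat.{max w uk} k where
  obj M := ModuleCat.of k (M.unop →ₗ[k] Q)
  map f := ModuleCat.ofHom (LinearMap.lcomp k Q f.unop.hom)

end Duality

/-! ## Complexes of length `n + 2` with prescribed end terms -/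

section Complexes

variable {C : Type u} [Category.{v} C] [Preadditive C]

/-- A complex `A = X₀ ⟶ X₁ ⟶ ⋯ ⟶ Xₙ ⟶ Xₙ₊₁ = B` in `C`, i.e. a cochain complex vanishing
outside of the degrees `0, …, n+1` whose end terms are identified with `A` and `B`. -/
structure NComplex (n : ℕ) (A B : C) where
  cpx : CochainComplex C ℕ
  isZero : ∀ i, n + 1 < i → IsZero (cpx.X i)
  left : cpx.X 0 ≅ A
  right : cpx.X (n + 1) ≅ B

namespace NComplex

variable {n : ℕ} {A B : C}

/-- The term in degree `i`. -/
abbrev X (X : NComplex n A B) (i : ℕ) : C := X.cpx.X i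

/-- The differential in degree `i`. -/
abbrev d (X : NComplex n A B) (i : ℕ) : X.X i ⟶ X.X (i + 1) := X.cpx.d i (i + 1)

/-- The first differential, as a morphism starting at `A`. -/
def dFirst (X : NComplex n A B) : A ⟶ X.X 1 := X.left.inv ≫ X.d 0

/-- The last differential, as a morphism ending at `B`. -/
def dLast (X : NComplex n A B) : X.X n ⟶ B := X.d n ≫ X.right.hom

/-- `f : X ⟶ Y` has components `a` and `b` at the end terms. -/
structure Lifts {A' B' : C} (X : NComplex n A B) (Y : NComplex n A' B')
    (f : X.cpx ⟶ Y.cpx) (a : A ⟶ A') (b : B ⟶ B') : Prop where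
  left : X.left.inv ≫ f.f 0 ≫ Y.left.hom = a
  right : X.right.inv ≫ f.f (n + 1) ≫ Y.right.hom = b

/-- Homotopy equivalence of complexes with the same end terms, through morphisms that are the
identity on both end terms. (The homotopies are automatically compatible with this condition,
since `f` and `g` are homotopic with equal end components iff the homotopy satisfies
`φ₁ d₀ = 0` and `dₙ φₙ₊₁ = 0`.) -/
def HtpyEquiv (X Y : NComplex n A B) : Prop :=
  ∃ e : HomotopyEquiv X.cpx Y.cpx,
    Lifts X Y e.hom (𝟙 A) (𝟙 B) ∧ Lifts Y X e.inv (𝟙 A) (𝟙 B)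

theorem Lifts.id (X : NComplex n A B) : Lifts X X (𝟙 X.cpx) (𝟙 A) (𝟙 B) :=
  ⟨by simp, by simp⟩

theorem Lifts.comp {A' B' A'' B'' : C} {X : NComplex n A B} {Y : NComplex n A' B'}
    {Z : NComplex n A'' B''} {f : X.cpx ⟶ Y.cpx} {g : Y.cpx ⟶ Z.cpx}
    {a : A ⟶ A'} {b : B ⟶ B'} {a' : A' ⟶ A''} {b' : B' ⟶ B''}
    (hf : Lifts X Y f a b) (hg : Lifts Y Z g a' b') :
    Lifts X Z (f ≫ g) (a ≫ a') (b ≫ b') := by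
  constructor
  · rw [← hf.left, ← hg.left]; simp
  · rw [← hf.right, ← hg.right]; simp

/-- Homotopy equivalence is an equivalence relation on complexes with fixed end terms. -/
instance setoid (n : ℕ) (A B : C) : Setoid (NComplex n A B) where
  r := HtpyEquiv
  iseqv :=
    { refl := fun X => ⟨HomotopyEquiv.refl X.cpx, Lifts.id X, Lifts.id X⟩
      symm := fun ⟨e, h, h'⟩ => ⟨e.symm, h', h⟩
      trans := fun ⟨e, h, h'⟩ ⟨e', g, g'⟩ =>
        ⟨e.trans e', by simpa using h.comp g, by simpa using g'.comp h'⟩ }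

end NComplex

/-- Homotopy equivalence classes of complexes `A ⟶ X₁ ⟶ ⋯ ⟶ Xₙ ⟶ B`. -/
def HtpyClass (n : ℕ) (A B : C) : Type (max u v) := Quotient (NComplex.setoid n A B)

variable [HasFiniteBiproducts C]

/-- `M` is (isomorphic, by an isomorphism that is the identity at the end terms, to) the mapping
cone
`X₁ ⟶ X₂ ⊕ Y₁ ⟶ X₃ ⊕ Y₂ ⟶ ⋯ ⟶ Xₙ₊₁ ⊕ Yₙ ⟶ Yₙ₊₁`
of a morphism `f : X ⟶ Y` that is the identity on `X₀ = Y₀ = A`. The differentials are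
`(-d, f)`, then the matrices with rows `(-d, 0)` and `(f, d)`, and finally `(f, d)`. -/
structure IsMappingCone {n : ℕ} {A B D : C} {X : NComplex n A B} {Y : NComplex n A D}
    (f : X.cpx ⟶ Y.cpx) (M : NComplex n (X.X 1) D)
    (e : ∀ i, 1 ≤ i → i ≤ n → (M.X i ≅ X.X (i + 1) ⊞ Y.X i)) : Prop where
  first : ∀ h : 1 ≤ n,
    M.dFirst ≫ (e 1 le_rfl h).hom = biprod.lift (-X.d 1) (f.f 1)
  middle : ∀ (i : ℕ) (h₁ : 1 ≤ i) (h₂ : i + 1 ≤ n),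
    (e i h₁ (by omega)).inv ≫ M.d i ≫ (e (i + 1) (by omega) h₂).hom =
      biprod.desc (biprod.lift (-X.d (i + 1)) (f.f (i + 1))) (biprod.lift 0 (Y.d i))
  last : ∀ h : 1 ≤ n,
    (e n h le_rfl).inv ≫ M.dLast = biprod.desc (f.f (n + 1) ≫ Y.right.hom) Y.dLast

/-- `N` is (isomorphic, by an isomorphism that is the identity at the end terms, to) the mapping
cocone
`X₀ ⟶ X₁ ⊕ Y₀ ⟶ X₂ ⊕ Y₁ ⟶ ⋯ ⟶ Xₙ ⊕ Yₙ₋₁ ⟶ Yₙ`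
of a morphism `f : X ⟶ Y` that is the identity on `Xₙ₊₁ = Yₙ₊₁ = D`; this is the mapping cone of
`f` in the opposite category. The differentials are `(d, f)`, then the matrices with rows
`(d, 0)` and `(f, -d)`, and finally `(f, -d)`. -/
structure IsMappingCocone {n : ℕ} {A B D : C} {X : NComplex n A D} {Y : NComplex n B D}
    (f : X.cpx ⟶ Y.cpx) (N : NComplex n A (Y.X n))
    (e : ∀ i, 1 ≤ i → i ≤ n → (N.X i ≅ X.X i ⊞ Y.X (i - 1))) : Prop where
  first : ∀ h : 1 ≤ n,
    N.dFirst ≫ (e 1 le_rfl h).hom = biprod.lift X.dFirst (X.left.inv ≫ f.f 0)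
  middle : ∀ (i : ℕ) (h₁ : 1 ≤ i) (h₂ : i + 1 ≤ n),
    (e i h₁ (by omega)).inv ≫ N.d i ≫ (e (i + 1) (by omega) h₂).hom =
      biprod.desc (biprod.lift (X.d i) (f.f i)) (biprod.lift 0 (-Y.cpx.d (i - 1) i))
  last : ∀ h : 1 ≤ n,
    (e n h le_rfl).inv ≫ N.dLast = biprod.desc (f.f n) (-Y.cpx.d (n - 1) n)

end Complexes

/-! ## `n`-exangulated categories -/

section Exangulated

variable (k : Type uk) [CommRing k] (C : Type u) [Category.{v} C] [Preadditive C] [Linear k C]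

/-- A `k`-bilinear bifunctor `𝔼 : Cᵒᵖ × C ⥤ Mod k`. -/
structure ExtBifunctor where
  functor : Cᵒᵖ ⥤ C ⥤ ModuleCat.{w} k
  map_add_right : ∀ (B : C) {A A' : C} (a a' : A ⟶ A'),
    (functor.obj (op B)).map (a + a') =
      (functor.obj (op B)).map a + (functor.obj (op B)).map a'
  map_smul_right : ∀ (B : C) {A A' : C} (r : k) (a : A ⟶ A'),
    (functor.obj (op B)).map (r • a) = r • (functor.obj (op B)).map a
  map_add_left : ∀ (A : C) {B B' : C} (c c' : B' ⟶ B),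
    (functor.map (c + c').op).app A = (functor.map c.op).app A + (functor.map c'.op).app A
  map_smul_left : ∀ (A : C) {B B' : C} (r : k) (c : B' ⟶ B),
    (functor.map (r • c).op).app A = r • (functor.map c.op).app A

variable {k C}

namespace ExtBifunctor

variable (E : ExtBifunctor.{w} k C)

/-- The `k`-module `𝔼(B, A)` of extensions. -/
abbrev Ext (B A : C) : Type w := (E.functor.obj (op B)).obj A

/-- `a_* : 𝔼(B, A) ⟶ 𝔼(B, A')`. -/
def push {B A A' : C} (a : A ⟶ A') : E.Ext B A →ₗ[k] E.Ext B A' :=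
  ((E.functor.obj (op B)).map a).hom

/-- `c^* : 𝔼(B, A) ⟶ 𝔼(B', A)`. -/
def pull {B B' A : C} (c : B' ⟶ B) : E.Ext B A →ₗ[k] E.Ext B' A :=
  ((E.functor.map c.op).app A).hom

/-- `⟨X, δ⟩` is an `n`-exangle: an `𝔼`-attached complex such that the sequences
`C(-, X₀) ⟶ ⋯ ⟶ C(-, Xₙ₊₁) ⟶ 𝔼(-, X₀)` and `C(Xₙ₊₁, -) ⟶ ⋯ ⟶ C(X₀, -) ⟶ 𝔼(Xₙ₊₁, -)`
are exact. -/
structure IsExangle {n : ℕ} {A B : C} (X : NComplex n A B) (δ : E.Ext B A) : Prop where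
  push_dFirst : E.push X.dFirst δ = 0
  pull_dLast : E.pull X.dLast δ = 0
  exact_right : ∀ i < n, ∀ ⦃T : C⦄ (g : T ⟶ X.X (i + 1)), g ≫ X.d (i + 1) = 0 →
    ∃ h : T ⟶ X.X i, h ≫ X.d i = g
  exact_right_last : ∀ ⦃T : C⦄ (g : T ⟶ B), E.pull g δ = 0 → ∃ h : T ⟶ X.X n, h ≫ X.dLast = g
  exact_left : ∀ i < n, ∀ ⦃T : C⦄ (g : X.X (i + 1) ⟶ T), X.d i ≫ g = 0 →
    ∃ h : X.X (i + 2) ⟶ T, X.d (i + 1) ≫ h = g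
  exact_left_first : ∀ ⦃T : C⦄ (g : A ⟶ T), E.push g δ = 0 →
    ∃ h : X.X 1 ⟶ T, X.dFirst ≫ h = g

/-- A correspondence `𝔰` which associates to each extension `δ ∈ 𝔼(B, A)` a homotopy equivalence
class of complexes `A ⟶ X₁ ⟶ ⋯ ⟶ Xₙ ⟶ B`. -/
def Correspondence (n : ℕ) : Type (max u v w) :=
  ∀ ⦃A B : C⦄, E.Ext B A → HtpyClass n A B

namespace Correspondence

variable {E} {n : ℕ} (s : E.Correspondence n)

/-- `X` realizes `δ`, i.e. `𝔰(δ) = [X]`. -/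
def Realizes {A B : C} (X : NComplex n A B) (δ : E.Ext B A) : Prop :=
  s δ = Quotient.mk _ X

/-- `𝔰` is an exact realization of `𝔼`. -/
structure IsExactRealization : Prop where
  R0 : ∀ ⦃A B A' B' : C⦄ (δ : E.Ext B A) (ρ : E.Ext B' A')
    (X : NComplex n A B) (Y : NComplex n A' B'), s.Realizes X δ → s.Realizes Y ρ →
    ∀ (a : A ⟶ A') (b : B ⟶ B'), E.push a δ = E.pull b ρ →
      ∃ f : X.cpx ⟶ Y.cpx, NComplex.Lifts X Y f a b
  R1 : ∀ ⦃A B : C⦄ (δ : E.Ext B A) (X : NComplex n A B), s.Realizes X δ → E.IsExangle X δ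
  /-- `𝔰(0) = [A = A ⟶ 0 ⟶ ⋯ ⟶ 0]` for `0 ∈ 𝔼(0, A)`. -/
  R2 : ∀ A Z : C, IsZero Z → ∃ X : NComplex n A Z, s.Realizes X 0 ∧
    IsIso (X.d 0) ∧ ∀ i, 2 ≤ i → IsZero (X.X i)
  /-- `𝔰(0) = [0 ⟶ ⋯ ⟶ 0 ⟶ A = A]` for `0 ∈ 𝔼(A, 0)`. -/
  R2_op : ∀ A Z : C, IsZero Z → ∃ X : NComplex n Z A, s.Realizes X 0 ∧
    IsIso (X.d n) ∧ ∀ i, i < n → IsZero (X.X i)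

/-- `f` is an `𝔰`-inflation: the first differential of a conflation. -/
def IsInflation {X₀ X₁ : C} (f : X₀ ⟶ X₁) : Prop :=
  ∃ (B : C) (δ : E.Ext B X₀) (X : NComplex n X₀ B) (e : X.X 1 ≅ X₁),
    s.Realizes X δ ∧ X.dFirst ≫ e.hom = f

/-- `g` is an `𝔰`-deflation: the last differential of a conflation. -/
def IsDeflation {Xₙ B : C} (g : Xₙ ⟶ B) : Prop :=
  ∃ (A : C) (δ : E.Ext B A) (X : NComplex n A B) (e : X.X n ≅ Xₙ),
    s.Realizes X δ ∧ e.inv ≫ X.dLast = g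

end Correspondence

end ExtBifunctor

variable (k C)

/-- A `k`-linear `n`-exangulated category structure `(C, 𝔼, 𝔰)` on the additive `k`-linear
category `C`. -/
structure NExangulated [HasFiniteBiproducts C] (n : ℕ) where
  E : ExtBifunctor.{w} k C
  s : E.Correspondence n
  exact : s.IsExactRealization
  EA1 : ∀ ⦃X Y Z : C⦄ (f : X ⟶ Y) (g : Y ⟶ Z),
    s.IsInflation f → s.IsInflation g → s.IsInflation (f ≫ g)
  EA1_op : ∀ ⦃X Y Z : C⦄ (f : X ⟶ Y) (g : Y ⟶ Z),
    s.IsDeflation f → s.IsDeflation g → s.IsDeflation (f ≫ g)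
  /-- `(1_A, c)` has a lift whose mapping cone, with the extension `(d₀)_* ρ`, is
  distinguished. -/
  EA2 : ∀ ⦃A B D : C⦄ (ρ : E.Ext D A) (c : B ⟶ D) (X : NComplex n A B) (Y : NComplex n A D),
    s.Realizes X (E.pull c ρ) → s.Realizes Y ρ →
    ∃ f : X.cpx ⟶ Y.cpx, NComplex.Lifts X Y f (𝟙 A) c ∧
      ∃ M e, IsMappingCone f M e ∧ s.Realizes M (E.push X.dFirst ρ)
  /-- `(a, 1_D)` has a lift whose mapping cocone, with the extension `(dₙ)^* ρ`, is
  distinguished. -/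
  EA2_op : ∀ ⦃A B D : C⦄ (ρ : E.Ext D A) (a : A ⟶ B) (X : NComplex n A D) (Y : NComplex n B D),
    s.Realizes X ρ → s.Realizes Y (E.push a ρ) →
    ∃ f : X.cpx ⟶ Y.cpx, NComplex.Lifts X Y f a (𝟙 D) ∧
      ∃ N e, IsMappingCocone f N e ∧ s.Realizes N (E.pull Y.dLast ρ)

variable {k C}

namespace NExangulated

variable [HasFiniteBiproducts C] {n : ℕ} (𝓒 : NExangulated.{w} k C n)

/-- `⟨X, δ⟩` is a distinguished `n`-exangle. -/
abbrev Distinguished {A B : C} (X : NComplex n A B) (δ : 𝓒.E.Ext B A) : Prop :=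
  𝓒.s.Realizes X δ

/-- `f` is an inflation. -/
abbrev Inflation {X Y : C} (f : X ⟶ Y) : Prop := 𝓒.s.IsInflation f

/-- `f` is a deflation. -/
abbrev Deflation {X Y : C} (f : X ⟶ Y) : Prop := 𝓒.s.IsDeflation f

/-- The `Ext`-finiteness condition: all `𝔼(B, A)` are finitely generated `k`-modules. -/
def ExtFinite : Prop := ∀ A B : C, Module.Finite k (𝓒.E.Ext B A)

/-- The analogue of the (WIC) condition. -/
structure WIC : Prop where
  deflation : ∀ ⦃X Y Z : C⦄ (f : X ⟶ Y) (g : Y ⟶ Z), 𝓒.Deflation (f ≫ g) → 𝓒.Deflation g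
  inflation : ∀ ⦃X Y Z : C⦄ (f : X ⟶ Y) (g : Y ⟶ Z), 𝓒.Inflation (f ≫ g) → 𝓒.Inflation f

/-- `P` is projective. -/
def IsProjective (P : C) : Prop :=
  ∀ ⦃A B : C⦄ (δ : 𝓒.E.Ext B A) (X : NComplex n A B), 𝓒.Distinguished X δ →
    ∀ c : P ⟶ B, FactorsThrough c X.dLast

/-- `f` is `n`-projectively trivial. -/
def ProjTrivial {X Y : C} (f : X ⟶ Y) : Prop :=
  ∀ (Z : C) (δ : 𝓒.E.Ext Y Z), 𝓒.E.pull f δ = 0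

/-- `f` is `n`-injectively trivial. -/
def InjTrivial {X Y : C} (f : X ⟶ Y) : Prop :=
  ∀ (Z : C) (δ : 𝓒.E.Ext Z X), 𝓒.E.push f δ = 0

/-- The relation on morphisms defining the costable category: `f - g` is `n`-injectively
trivial. -/
def costableRel : HomRel C := fun _ _ f g => 𝓒.InjTrivial (f - g)

theorem costableRel_iff {X Y : C} (f g : X ⟶ Y) :
    𝓒.costableRel f g ↔
      ∀ Z : C, (𝓒.E.functor.obj (op Z)).map f = (𝓒.E.functor.obj (op Z)).map g := by
  have key : ∀ Z : C, (𝓒.E.functor.obj (op Z)).map f =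
      (𝓒.E.functor.obj (op Z)).map (f - g) + (𝓒.E.functor.obj (op Z)).map g := fun Z => by
    rw [← 𝓒.E.map_add_right, sub_add_cancel]
  constructor
  · intro h Z
    have h0 : (𝓒.E.functor.obj (op Z)).map (f - g) = 0 := by
      ext δ
      exact h Z δ
    rw [key Z, h0, zero_add]
  · intro h Z δ
    have h0 : (𝓒.E.functor.obj (op Z)).map (f - g) = 0 := by
      have := key Z
      rw [h Z] at this
      simpa using this.symm
    simp [ExtBifunctor.push, h0]

/-- Hence the hom-sets of the costable category are exactly the quotients of `C(X, Y)` by the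
`n`-injectively trivial morphisms. -/
instance : Congruence 𝓒.costableRel where
  comp_left f _ _ h := by
    rw [costableRel_iff] at h ⊢
    intro Z; simp [h Z]
  comp_right g h := by
    rw [costableRel_iff] at h ⊢
    intro Z; simp [h Z]
  equivalence :=
    { refl := fun f => (𝓒.costableRel_iff f f).2 fun _ => rfl
      symm := fun h => (𝓒.costableRel_iff _ _).2 fun Z => ((𝓒.costableRel_iff _ _).1 h Z).symm
      trans := fun h h' => (𝓒.costableRel_iff _ _).2 fun Z =>
        ((𝓒.costableRel_iff _ _).1 h Z).trans ((𝓒.costableRel_iff _ _).1 h' Z) }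

/-- The costable category of `C`: same objects, morphisms modulo `n`-injectively trivial ones. -/
abbrev Costable : Type u := CategoryTheory.Quotient 𝓒.costableRel

/-- The functor `𝔼(X, -)` on the costable category. -/
def extCostable (X : C) : 𝓒.Costable ⥤ ModuleCat.{w} k :=
  CategoryTheory.Quotient.lift 𝓒.costableRel (𝓒.E.functor.obj (op X))
    (fun _ _ f g h => (𝓒.costableRel_iff f g).1 h X)

/-- The contravariant functor `D 𝔼(X, -)` on the costable category, where `D = Hom_k(-, Q)`. -/
def dualExt (Q : Type uk) [AddCommGroup Q] [Module k Q] (X : C) :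
    𝓒.Costableᵒᵖ ⥤ ModuleCat.{max w uk} k :=
  (𝓒.extCostable X).op ⋙ dual.{w} k Q

/-- `X` belongs to the subcategory `C_r`: the functor `D 𝔼(X, -)` on the costable category is
representable. (A natural bijection from `Hom(-, X')` to a `k`-linear functor is `k`-linear by
Yoneda, so representability can be tested on underlying sets.) -/
def InCr (Q : Type uk) [AddCommGroup Q] [Module k Q] (X : C) : Prop :=
  ∃ X' : 𝓒.Costable, Nonempty ((𝓒.dualExt Q X ⋙ forget (ModuleCat k)).RepresentableBy X')

/-- `⟨X, δ⟩` is an Auslander–Reiten `n`-exangle. -/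
structure IsAuslanderReiten {A B : C} (X : NComplex n A B) (δ : 𝓒.E.Ext B A) : Prop where
  distinguished : 𝓒.Distinguished X δ
  left : LeftAlmostSplit X.dFirst
  right : RightAlmostSplit X.dLast
  radical : ∀ i, 1 ≤ i → i < n → InRadical (X.d i)

/-- `W` is the intrinsic weak `n`-cokernel of the inflation `f : X₀ ⟶ X₁`: there is a distinguished
`n`-exangle `X₀ ⟶ Z₁ ⟶ ⋯ ⟶ Zₙ ⟶ W` whose first morphism is a left minimal version of `f` and whose
other morphisms `Z₁ ⟶ Z₂, …, Zₙ ⟶ W` are all in the radical. -/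
def IsIntrinsicWeakCokernel {X₀ X₁ : C} (f : X₀ ⟶ X₁) (W : C) : Prop :=
  ∃ (δ : 𝓒.E.Ext W X₀) (Z : NComplex n X₀ W), 𝓒.Distinguished Z δ ∧
    LeftMinimal Z.dFirst ∧ LeftEquivalent f Z.dFirst ∧
    ∀ i, 1 ≤ i → i ≤ n → InRadical (Z.d i)

end NExangulated

end Exangulated

end

end NExang

/-! The hub of the proof is `HasPushEssential X`: there is a nonzero extension δ in 𝔼(X, A) to which
every nonzero extension of X can be pushed out. By the exact sequence C(A, -) ⟶ 𝔼(X, -) ⟶ 𝔼(Xₙ, -)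
(`exists_push_eq`), a nonzero δ has this property as soon as it is killed by pulling back along all
morphisms to X that are not split epimorphisms. Passing to a component of δ at a local summand of A,
one may assume that all non-split monomorphisms kill δ; the dual sequence (`exists_pull_eq`) then
makes δ essential for pull-backs as well. If X has local endomorphism ring, a realization of such a
δ whose inner differentials are radical is an Auslander–Reiten n-exangle.

For (1), a functional φ with φ(δ) ≠ 0 on a two-sided essential δ defines pairings of C(T, A) with
𝔼(X, T) that are perfect modulo injectively trivial morphisms; Matlis duality for finitely generated
modules turns this into representability (`exists_isDualizing_of_essential`). Conversely, a
representing object is a functional φ, and the pairing of C(X, Y) with 𝔼(Y, A) has only projectively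
trivial morphisms in its left kernel and no right kernel. A submodule H as in (2) is then recovered
from its annihilator, and a finite generating family of the annihilator, assembled into one
extension by a power of A, is realized by the required deflation.

From (2) one returns to (1) by taking for H the radical morphisms from C to each nonprojective local
summand of C; projective summands have zero Ext, and dualizing functionals add up over direct sums.
In (3) and (5), determination supplies a nonzero family of extensions inside one Ext-module of
finite length, and a member generating a minimal submodule yields the essential extension. In (6) it
is the pull-back along the morphism that almost factors. -/

namespace NExang

/-! ### Matlis duality for the minimal injective cogenerator -/

section Matlis

variable {k : Type uk} [CommRing k] {Q : Type uk} [AddCommGroup Q] [Module k Q]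

theorem IsInjectiveCogenerator.baer (hQ : IsInjectiveCogenerator k Q) : Module.Baer k Q :=
  Module.Baer.of_injective hQ.injective

/-- Every nonzero element of a module has a nonzero image in a simple quotient
of the submodule it generates. -/
theorem exists_simple_quotient {M : Type w} [AddCommGroup M] [Module k M] {m : M} (hm : m ≠ 0) :
    ∃ (S : Type uk) (_ : AddCommGroup S) (_ : Module k S) (_ : IsSimpleModule k S)
      (σ : Submodule.span k {m} →ₗ[k] S), σ ⟨m, Submodule.mem_span_singleton_self m⟩ ≠ 0 := by
  have hne : Ideal.torsionOf k M m ≠ ⊤ := by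
    rw [Ne, Ideal.torsionOf_eq_top_iff]; exact hm
  obtain ⟨I, hI, hle⟩ := Ideal.exists_le_maximal _ hne
  -- A quotient of `k` lives in the universe in which `cogenerates` is stated, whatever the universe
  -- of `M`.
  refine ⟨k ⧸ I, inferInstance, inferInstance,
    isSimpleModule_iff_isCoatom.2 (Ideal.isMaximal_def.1 hI),
    (Submodule.factor hle) ∘ₗ
      (Ideal.quotTorsionOfEquivSpanSingleton k M m).symm.toLinearMap, ?_⟩
  have h1 : (Ideal.quotTorsionOfEquivSpanSingleton k M m).symm
      ⟨m, Submodule.mem_span_singleton_self m⟩ = Submodule.Quotient.mk 1 := by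
    rw [LinearEquiv.symm_apply_eq, Ideal.quotTorsionOfEquivSpanSingleton_apply_mk]
    simp
  rw [LinearMap.comp_apply, LinearEquiv.coe_coe, h1]
  intro h0
  have : (Submodule.Quotient.mk 1 : k ⧸ I) = 0 := h0
  rw [Submodule.Quotient.mk_eq_zero] at this
  exact hI.ne_top ((Ideal.eq_top_iff_one I).2 this)

/-- An injective cogenerator separates points of modules in any universe. -/
theorem IsInjectiveCogenerator.exists_ne_zero (hQ : IsInjectiveCogenerator k Q)
    {M : Type w} [AddCommGroup M] [Module k M] {m : M} (hm : m ≠ 0) :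
    ∃ φ : M →ₗ[k] Q, φ m ≠ 0 := by
  obtain ⟨S, _, _, _, σ, hσ⟩ := exists_simple_quotient (k := k) hm
  obtain ⟨τ, hτ⟩ := hQ.cogenerates S _ hσ
  obtain ⟨φ, hφ⟩ := hQ.baer.extension_property (Submodule.span k {m}).subtype
    (Submodule.subtype_injective _) (τ ∘ₗ σ)
  exact ⟨φ, by
    have := LinearMap.congr_fun hφ ⟨m, Submodule.mem_span_singleton_self m⟩
    simp only [LinearMap.comp_apply, Submodule.subtype_apply] at this
    rwa [this]⟩

theorem Baer.of_isCompl {N R : Submodule k Q} (hQ : Module.Baer k Q) (h : IsCompl N R) :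
    Module.Baer k R := fun I g => by
  obtain ⟨g', hg'⟩ := hQ I (R.subtype ∘ₗ g)
  exact ⟨Submodule.projectionOnto R N h.symm ∘ₗ g', fun x hx => by
    rw [LinearMap.comp_apply, hg' x hx, LinearMap.comp_apply, Submodule.subtype_apply,
      Submodule.projectionOnto_apply_left]⟩

variable [IsArtinianRing k]

/-- Isomorphic simple submodules of a minimal injective cogenerator agree. -/
theorem IsMinimalInjectiveCogenerator.eq_of_linearEquiv
    (hQ : IsMinimalInjectiveCogenerator k Q) (P₁ P₂ : Submodule k Q) [IsSimpleModule k P₁]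
    (e : P₁ ≃ₗ[k] P₂) : P₁ = P₂ := by
  have := hQ.finite
  have hP₂ : IsSimpleModule k P₂ := e.isSimpleModule_iff.1 inferInstance
  by_contra hne
  -- If P₁ and P₂ differed, P₁ would be redundant: an endomorphism θ of Q is built that kills P₁ and
  -- projects the socle T onto a complement of it. A Fitting summand of Q on which θ is invertible
  -- is then still a cogenerator, against minimality.
  set T : Submodule k Q := ⨆ P ∈ {P : Submodule k Q | IsSimpleModule k P}, P with hT
  have hTs : IsSemisimpleModule k T :=
    isSemisimpleModule_biSup_of_isSemisimpleModule_submodule fun P hP => by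
      have : IsSimpleModule k P := hP
      infer_instance
  have hle : ∀ P : Submodule k Q, IsSimpleModule k P → P ≤ T := fun P hP =>
    le_biSup (fun P : Submodule k Q => P) hP
  obtain ⟨W, hW⟩ := exists_isCompl (P₁.submoduleOf T)
  obtain ⟨θ, hθ⟩ := hQ.baer.extension_property T.subtype T.subtype_injective
    (T.subtype ∘ₗ W.subtype ∘ₗ Submodule.projectionOnto W _ hW.symm)
  have hθ' : ∀ x : T, θ x = (Submodule.projectionOnto W _ hW.symm x : T) := fun x =>
    LinearMap.congr_fun hθ x
  have hθ0 : ∀ x ∈ T, θ x = 0 ↔ x ∈ P₁ := fun x hx => by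
    rw [hθ' ⟨x, hx⟩]
    simp only [ZeroMemClass.coe_eq_zero]
    rw [Submodule.projectionOnto_apply_eq_zero_iff, Submodule.submoduleOf, Submodule.mem_comap,
      Submodule.subtype_apply]
  have hθθ : ∀ x ∈ T, θ (θ x) = θ x := fun x hx => by
    rw [hθ' ⟨x, hx⟩, hθ', Submodule.projectionOnto_apply_left]
  -- Fitting's lemma: the range of a high power of θ is a direct summand of Q, hence injective. The
  -- exponent is taken positive because θ is idempotent on T, so that θ and all its positive powers
  -- agree there.
  obtain ⟨N, hN, hN1⟩ := ((LinearMap.eventually_isCompl_ker_pow_range_pow θ).and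
    (Filter.eventually_ge_atTop 1)).exists
  have hpow : ∀ x ∈ T, ∀ m, (θ ^ (m + 1)) x = θ x := fun x hx m => by
    induction m with
    | zero => simp
    | succ m ih => rw [pow_succ', Module.End.mul_apply, ih, hθθ x hx]
  obtain ⟨m, rfl⟩ : ∃ m, N = m + 1 := ⟨N - 1, by omega⟩
  set R := LinearMap.range (θ ^ (m + 1)) with hR
  have hRb := Baer.of_isCompl hQ.baer hN
  have hRtop : R = ⊤ := by
    refine hQ.minimal R ⟨inferInstance, hRb.injective, fun M _ _ _ x hx => ?_⟩
    obtain ⟨S, _, _, _, σ, hσ⟩ := exists_simple_quotient (k := k) hx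
    obtain ⟨ρ, hρT, hρ⟩ : ∃ ρ : S →ₗ[k] Q, (∀ s, ρ s ∈ T) ∧ θ ∘ₗ ρ ≠ 0 := by
      obtain ⟨τ, hτ⟩ := hQ.cogenerates S _ hσ
      have hτ0 : τ ≠ 0 := fun h => hτ (by simp [h])
      have hinj := LinearMap.injective_of_ne_zero hτ0
      have hrs : IsSimpleModule k (LinearMap.range τ) :=
        (LinearEquiv.ofInjective τ hinj).isSimpleModule_iff.1 inferInstance
      have hτT : ∀ s, τ s ∈ T := fun s => hle _ hrs ⟨s, rfl⟩
      by_cases h0 : θ ∘ₗ τ = 0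
      -- Here S embeds onto P₁ and is lost under θ. It is redirected to P₂, which meets the kernel
      -- of θ trivially, since the atoms P₁ and P₂ are distinct.
      · have hmem : ∀ s, τ s ∈ P₁ := fun s =>
          (hθ0 _ (hτT s)).1 (LinearMap.congr_fun h0 s)
        refine ⟨P₂.subtype ∘ₗ e.toLinearMap ∘ₗ τ.codRestrict P₁ hmem,
          fun s => hle _ hP₂ (Submodule.coe_mem _), fun h1 => ?_⟩
        have hsurj : Function.Surjective (τ.codRestrict P₁ hmem) :=
          LinearMap.surjective_of_ne_zero fun h2 => hτ0 <| LinearMap.ext fun s => by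
            simpa using congrArg Subtype.val (LinearMap.congr_fun h2 s)
        have hle21 : P₂ ≤ P₁ := fun y hy => by
          obtain ⟨s, hs⟩ := hsurj (e.symm ⟨y, hy⟩)
          have := LinearMap.congr_fun h1 s
          simp only [LinearMap.comp_apply, hs, LinearEquiv.coe_coe, LinearEquiv.apply_symm_apply,
            Submodule.subtype_apply, LinearMap.zero_apply] at this
          exact (hθ0 y (hle _ hP₂ hy)).1 this
        have a1 : IsAtom P₁ := isSimpleModule_iff_isAtom.1 inferInstance
        have a2 : IsAtom P₂ := isSimpleModule_iff_isAtom.1 inferInstance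
        exact hne ((a1.le_iff.1 hle21).resolve_left a2.1).symm
      · exact ⟨τ, hτT, h0⟩
    have hmem : ∀ s, (θ ∘ₗ ρ) s ∈ R := fun s => ⟨ρ s, hpow _ (hρT s) m⟩
    obtain ⟨φ, hφ⟩ := hRb.extension_property (Submodule.span k {x}).subtype
      (Submodule.subtype_injective _) ((θ ∘ₗ ρ).codRestrict R hmem ∘ₗ σ)
    refine ⟨φ, fun h0 => hσ ?_⟩
    have h1 := LinearMap.congr_fun hφ ⟨x, Submodule.mem_span_singleton_self x⟩
    simp only [LinearMap.comp_apply, Submodule.subtype_apply, h0] at h1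
    have h2 := congrArg Subtype.val h1
    exact LinearMap.injective_of_ne_zero hρ (by simpa using h2.symm)
  have hbot : LinearMap.ker (θ ^ (m + 1)) = ⊥ := by
    rw [← inf_top_eq (LinearMap.ker (θ ^ (m + 1))), ← hRtop]
    exact hN.inf_eq_bot
  have a1 : IsAtom P₁ := isSimpleModule_iff_isAtom.1 inferInstance
  refine a1.1 (le_bot_iff.1 fun x hx => ?_)
  rw [← hbot, LinearMap.mem_ker, hpow x (hle _ inferInstance hx)]
  exact (hθ0 x (hle _ inferInstance hx)).2 hx

/-- Two nonzero maps from S to Q are injective with isomorphic, hence equal, images. They therefore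
differ by an automorphism of S, and this is a scalar because S is cyclic over a commutative ring. -/
theorem IsMinimalInjectiveCogenerator.length_dual_simple_le
    (hQ : IsMinimalInjectiveCogenerator k Q) (S : Type w) [AddCommGroup S] [Module k S]
    [IsSimpleModule k S] : Module.length k (S →ₗ[k] Q) ≤ 1 := by
  rcases subsingleton_or_nontrivial (S →ₗ[k] Q) with h | h
  · rw [Module.length_eq_zero]; exact zero_le_one
  · refine (Module.length_eq_one_iff.2 ?_).le
    rw [isSimpleModule_iff_toSpanSingleton_surjective]
    refine ⟨h, fun φ hφ ψ => ?_⟩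
    by_cases hψ : ψ = 0
    · exact ⟨0, by simp [hψ]⟩
    have hi := LinearMap.injective_of_ne_zero hφ
    have hj := LinearMap.injective_of_ne_zero hψ
    have hs : IsSimpleModule k (LinearMap.range φ) :=
      (LinearEquiv.ofInjective φ hi).isSimpleModule_iff.1 inferInstance
    have heq := hQ.eq_of_linearEquiv (LinearMap.range φ) (LinearMap.range ψ)
      ((LinearEquiv.ofInjective φ hi).symm ≪≫ₗ LinearEquiv.ofInjective ψ hj)
    have := IsSimpleModule.nontrivial k S
    obtain ⟨s, hs0⟩ := exists_ne (0 : S)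
    obtain ⟨t, ht⟩ : ψ s ∈ LinearMap.range φ := heq ▸ ⟨s, rfl⟩
    obtain ⟨r, rfl⟩ := IsSimpleModule.toSpanSingleton_surjective k hs0 t
    refine ⟨r, LinearMap.ext fun x => ?_⟩
    obtain ⟨r', rfl⟩ := IsSimpleModule.toSpanSingleton_surjective k hs0 x
    simp only [LinearMap.toSpanSingleton_apply, map_smul, LinearMap.smul_apply] at ht ⊢
    rw [← ht, smul_comm]

/-- Induction along a composition series: restriction to N has image inside the dual of N, and its
kernel embeds in the dual of the simple module M / N. -/
theorem IsMinimalInjectiveCogenerator.length_dual_le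
    (hQ : IsMinimalInjectiveCogenerator k Q) {M : Type w} [AddCommGroup M] [Module k M]
    (hM : IsFiniteLength k M) : Module.length k (M →ₗ[k] Q) ≤ Module.length k M := by
  induction hM with
  | of_subsingleton => rw [Module.length_eq_zero]; exact zero_le
  | @of_simple_quotient M _ _ N _ _ ih =>
    have hres := Module.length_eq_add_of_exact
      (LinearMap.ker (LinearMap.lcomp k Q N.subtype)).subtype
      (LinearMap.lcomp k Q N.subtype).rangeRestrict (Submodule.subtype_injective _)
      (LinearMap.surjective_rangeRestrict _) (by
        rw [LinearMap.exact_iff, LinearMap.ker_rangeRestrict, Submodule.range_subtype])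
    have h1 : Module.length k (LinearMap.range (LinearMap.lcomp k Q N.subtype)) ≤
        Module.length k N :=
      (Module.length_le_of_injective _ (Submodule.subtype_injective _)).trans ih
    have h2 : Module.length k (LinearMap.ker (LinearMap.lcomp k Q N.subtype)) ≤
        Module.length k (M ⧸ N) := by
      have hmem : ∀ ψ : LinearMap.ker (LinearMap.lcomp k Q N.subtype),
          N ≤ LinearMap.ker ψ.1 := fun ψ x hx => LinearMap.congr_fun ψ.2 ⟨x, hx⟩
      let g : LinearMap.ker (LinearMap.lcomp k Q N.subtype) →ₗ[k] (M ⧸ N →ₗ[k] Q) :=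
        { toFun := fun ψ => N.liftQ ψ.1 (hmem ψ)
          map_add' := fun a b => by ext; simp
          map_smul' := fun a b => by ext; simp }
      refine (Module.length_le_of_injective g fun a b hab => ?_).trans
        ((hQ.length_dual_simple_le (M ⧸ N)).trans (Module.length_eq_one k (M ⧸ N)).ge)
      ext x
      exact LinearMap.congr_fun hab (Submodule.Quotient.mk x)
    rw [hres, Module.length_eq_add_of_exact N.subtype N.mkQ N.subtype_injective N.mkQ_surjective
      (LinearMap.exact_subtype_mkQ N), add_comm]
    exact add_le_add h1 h2

/-- Finitely generated modules are reflexive for the duality into the minimal injective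
cogenerator. -/
theorem IsMinimalInjectiveCogenerator.exists_eval_eq
    (hQ : IsMinimalInjectiveCogenerator k Q) {M : Type w} [AddCommGroup M] [Module k M]
    [Module.Finite k M] (Ψ : (M →ₗ[k] Q) →ₗ[k] Q) : ∃ x : M, ∀ φ : M →ₗ[k] Q, Ψ φ = φ x := by
  have hM : IsFiniteLength k M :=
    isFiniteLength_iff_isNoetherian_isArtinian.2 ⟨inferInstance, inferInstance⟩
  let ev : M →ₗ[k] ((M →ₗ[k] Q) →ₗ[k] Q) := LinearMap.flip LinearMap.id
  have hev : Function.Injective ev := by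
    rw [injective_iff_map_eq_zero]
    intro x hx
    by_contra h0
    obtain ⟨φ, hφ⟩ := hQ.exists_ne_zero h0
    exact hφ (LinearMap.congr_fun hx φ)
  -- The bidual is at most as long as M, and M embeds in it by evaluation; so the cokernel of
  -- evaluation has length zero.
  have hl := hQ.length_dual_le hM
  have hfin : IsFiniteLength k (M →ₗ[k] Q) := Module.length_ne_top_iff.1
    (ne_top_of_le_ne_top (Module.length_ne_top_iff.2 hM) hl)
  have hl2 := (hQ.length_dual_le hfin).trans hl
  have hex := Module.length_eq_add_of_exact ev (LinearMap.range ev).mkQ hev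
    (Submodule.mkQ_surjective _) (LinearMap.exact_map_mkQ_range ev)
  have h0 : Module.length k (((M →ₗ[k] Q) →ₗ[k] Q) ⧸ LinearMap.range ev) = 0 := by
    rw [hex] at hl2
    have hne := Module.length_ne_top_iff.2 hM
    exact nonpos_iff_eq_zero.1
      (ENat.addLECancellable_of_ne_top hne (by simpa only [add_zero] using hl2))
  rw [Module.length_eq_zero_iff, Submodule.Quotient.subsingleton_iff] at h0
  obtain ⟨x, hx⟩ := LinearMap.range_eq_top.1 h0 Ψ
  exact ⟨x, fun φ => by rw [← hx]; rfl⟩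

/-- If `U` pairs with the finitely generated module `N` without left kernel, then every functional
on `U` is given by an element of `N`. -/
theorem IsMinimalInjectiveCogenerator.exists_repr_left
    (hQ : IsMinimalInjectiveCogenerator k Q) {U : Type*} [AddCommGroup U] [Module k U]
    {N : Type w} [AddCommGroup N] [Module k N] [Module.Finite k N]
    (β : U →ₗ[k] N →ₗ[k] Q) (hβ : Function.Injective β) (ψ : U →ₗ[k] Q) :
    ∃ x : N, ∀ a, ψ a = β a x := by
  obtain ⟨Ψ, hΨ⟩ := hQ.baer.extension_property β hβ ψ
  obtain ⟨x, hx⟩ := hQ.exists_eval_eq Ψ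
  exact ⟨x, fun a => by rw [← hx, ← hΨ]; rfl⟩

/-- If `U` pairs with the finitely generated module `N` without right kernel, then every
functional on `N` is given by an element of `U`. -/
theorem IsMinimalInjectiveCogenerator.exists_repr_right
    (hQ : IsMinimalInjectiveCogenerator k Q) {U : Type*} [AddCommGroup U] [Module k U]
    {N : Type w} [AddCommGroup N] [Module k N] [Module.Finite k N]
    (β : U →ₗ[k] N →ₗ[k] Q) (hβ : ∀ x, (∀ a, β a x = 0) → x = 0) (ψ : N →ₗ[k] Q) :
    ∃ a, β a = ψ := by
  by_contra hψ
  -- A functional vanishing on the range of β but not at ψ is evaluation at some x by reflexivity;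
  -- this x lies in the right kernel, so it is zero.
  have hne : (LinearMap.range β).mkQ ψ ≠ 0 := fun h => hψ <| by
    rwa [Submodule.mkQ_apply, Submodule.Quotient.mk_eq_zero] at h
  obtain ⟨Ψ, hΨ⟩ := hQ.exists_ne_zero hne
  obtain ⟨x, hx⟩ := hQ.exists_eval_eq (Ψ ∘ₗ (LinearMap.range β).mkQ)
  have hx0 : x = 0 := hβ x fun a => by
    rw [← hx, LinearMap.comp_apply, Submodule.mkQ_apply,
      (Submodule.Quotient.mk_eq_zero _).2 (LinearMap.mem_range_self β a), map_zero]
  exact hΨ (by rw [← LinearMap.comp_apply, hx, hx0, map_zero])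

end Matlis

end NExang

namespace NExang

/-! ### The radical and local endomorphism rings -/

section Radical

variable {C : Type u} [Category.{v} C]

theorem isSplitMono_of_isIso_comp {X Y : C} (f : X ⟶ Y) (g : Y ⟶ X) (h : IsIso (f ≫ g)) :
    IsSplitMono f :=
  IsSplitMono.mk' ⟨g ≫ inv (f ≫ g), by rw [← Category.assoc, IsIso.hom_inv_id]⟩

theorem isSplitEpi_of_isIso_comp {X Y : C} (f : X ⟶ Y) (g : Y ⟶ X) (h : IsIso (g ≫ f)) :
    IsSplitEpi f :=
  IsSplitEpi.mk' ⟨inv (g ≫ f) ≫ g, by rw [Category.assoc, IsIso.inv_hom_id]⟩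

variable [Preadditive C]

/-- Jacobson's trick: if u inverts 1 - f ≫ g, then 1 + g ≫ u ≫ f inverts 1 - g ≫ f. -/
theorem isIso_one_sub_swap {X Y : C} (f : X ⟶ Y) (g : Y ⟶ X) (h : IsIso (𝟙 X - f ≫ g)) :
    IsIso (𝟙 Y - g ≫ f) := by
  obtain ⟨u, h1, h2⟩ := h
  have h1' : f ≫ g ≫ u = u - 𝟙 X := by
    rw [Preadditive.sub_comp, Category.id_comp, Category.assoc] at h1
    rw [← h1]; abel
  have h2' : u ≫ f ≫ g = u - 𝟙 X := by
    rw [Preadditive.comp_sub, Category.comp_id] at h2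
    rw [← h2]; abel
  refine ⟨𝟙 Y + g ≫ u ≫ f, ?_, ?_⟩
  · have : g ≫ f ≫ g ≫ u ≫ f = g ≫ (f ≫ g ≫ u) ≫ f := by simp
    simp only [Preadditive.sub_comp, Preadditive.comp_add, Category.id_comp, Category.comp_id,
      Category.assoc, this, h1', Preadditive.comp_sub]
    abel
  · have : g ≫ u ≫ f ≫ g ≫ f = g ≫ (u ≫ f ≫ g) ≫ f := by simp
    simp only [Preadditive.add_comp, Preadditive.comp_sub, Category.id_comp, Category.comp_id,
      Category.assoc, this, h2', Preadditive.sub_comp]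
    abel

theorem InRadical.comp_right {X Y Z : C} {f : X ⟶ Y} (hf : InRadical f) (u : Y ⟶ Z) :
    InRadical (f ≫ u) := fun g => by
  rw [Category.assoc]; exact hf _

theorem InRadical.comp_left {X Y Z : C} {f : X ⟶ Y} (hf : InRadical f) (u : Z ⟶ X) :
    InRadical (u ≫ f) := fun g => by
  rw [Category.assoc]
  refine isIso_one_sub_swap (f ≫ g) u ?_
  rw [Category.assoc]; exact hf _

theorem InRadical.add {X Y : C} {f g : X ⟶ Y} (hf : InRadical f) (hg : InRadical g) :
    InRadical (f + g) := fun h => by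
  have h1 := hf h
  have h2 := hg (h ≫ inv (𝟙 X - f ≫ h))
  have : 𝟙 X - (f + g) ≫ h = (𝟙 X - g ≫ h ≫ inv (𝟙 X - f ≫ h)) ≫ (𝟙 X - f ≫ h) := by
    rw [Preadditive.sub_comp _ _ (𝟙 X - f ≫ h), Category.assoc, Category.assoc,
      IsIso.inv_hom_id, Category.comp_id, Category.id_comp, Preadditive.add_comp]
    abel
  rw [this]
  infer_instance

theorem inRadical_zero (X Y : C) : InRadical (0 : X ⟶ Y) := fun g => by
  rw [zero_comp, sub_zero]; infer_instance

theorem InRadical.sum {X Y : C} {ι : Type*} (s : Finset ι) {f : ι → (X ⟶ Y)}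
    (hf : ∀ i ∈ s, InRadical (f i)) : InRadical (∑ i ∈ s, f i) :=
  Finset.sum_induction f InRadical (fun _ _ => InRadical.add) (inRadical_zero X Y) hf

theorem InRadical.isIso_one_sub_comp {X Y : C} {f : X ⟶ Y} (hf : InRadical f) (g : Y ⟶ X) :
    IsIso (𝟙 Y - g ≫ f) :=
  isIso_one_sub_swap f g (hf g)

theorem InRadical.not_isSplitEpi {X Y : C} {f : X ⟶ Y} (hf : InRadical f) (hY : ¬ IsZero Y) :
    ¬ IsSplitEpi f := fun h => hY <| by
  have h1 := hf.isIso_one_sub_comp (section_ f)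
  rw [IsSplitEpi.id, sub_self] at h1
  exact (IsZero.iff_id_eq_zero Y).2 (by rw [← IsIso.hom_inv_id (0 : Y ⟶ Y), zero_comp])

section Local

variable {X : C} [hX : IsLocalRing (End X)]

include hX

theorem not_isZero_of_isLocalRing : ¬ IsZero X := fun h =>
  (one_ne_zero : (1 : End X) ≠ 0) (h.eq_of_src _ _)

theorem isIso_or_isIso_one_sub (a : X ⟶ X) : IsIso a ∨ IsIso (𝟙 X - a) := by
  have := IsLocalRing.isUnit_or_isUnit_of_add_one (R := End X) (add_sub_cancel a (𝟙 X))
  exact this.imp (isUnit_iff_isIso _).1 (isUnit_iff_isIso _).1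

theorem isIso_or_isIso_of_add {a b : X ⟶ X} (h : IsIso (a + b)) : IsIso a ∨ IsIso b := by
  rcases isIso_or_isIso_one_sub (a ≫ inv (a + b)) with h1 | h1
  · exact Or.inl (IsIso.of_isIso_comp_right a (inv (a + b)))
  · have : 𝟙 X - a ≫ inv (a + b) = b ≫ inv (a + b) := by
      rw [← IsIso.hom_inv_id (a + b), Preadditive.add_comp, add_sub_cancel_left]
    rw [this] at h1
    exact Or.inr (IsIso.of_isIso_comp_right b (inv (a + b)))

theorem exists_isIso_of_sum {ι : Type*} (s : Finset ι) (f : ι → (X ⟶ X))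
    (h : IsIso (∑ i ∈ s, f i)) : ∃ i ∈ s, IsIso (f i) := by
  classical
  induction s using Finset.induction_on with
  | empty =>
    rw [Finset.sum_empty] at h
    exact (not_isZero_of_isLocalRing (X := X) ((IsZero.iff_id_eq_zero X).2
      (by rw [← IsIso.hom_inv_id (0 : X ⟶ X), zero_comp]))).elim
  | insert a s ha ih =>
    rw [Finset.sum_insert ha] at h
    rcases isIso_or_isIso_of_add h with h | h
    · exact ⟨a, Finset.mem_insert_self _ _, h⟩
    · obtain ⟨i, hi, h⟩ := ih h
      exact ⟨i, Finset.mem_insert_of_mem hi, h⟩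

theorem exists_isIso_comp_of_not_inRadical {Y : C} {f : X ⟶ Y} (hf : ¬ InRadical f) :
    ∃ g : Y ⟶ X, IsIso (f ≫ g) := by
  simp only [InRadical, not_forall] at hf
  obtain ⟨g, hg⟩ := hf
  exact ⟨g, (isIso_or_isIso_one_sub (f ≫ g)).resolve_right hg⟩

theorem inRadical_of_not_isSplitEpi {Y : C} {f : Y ⟶ X} (hf : ¬ IsSplitEpi f) :
    InRadical f := fun g => by
  refine isIso_one_sub_swap g f ((isIso_or_isIso_one_sub (g ≫ f)).resolve_left fun h => ?_)
  exact hf (isSplitEpi_of_isIso_comp f g h)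

/-- A factorization of the identity of a nonzero object through an object with local endomorphism
ring consists of isomorphisms. -/
theorem isIso_of_isIso_comp_of_isLocalRing {Z : C} (hZ : ¬ IsZero Z) (u : Z ⟶ X) (v : X ⟶ Z)
    (h : IsIso (u ≫ v)) : IsIso u := by
  -- An idempotent with u ≫ p = u. In a local ring p or 1 - p is invertible: the first forces p = 1,
  -- the second forces u = 0.
  set p : X ⟶ X := v ≫ inv (u ≫ v) ≫ u with hp
  have hup : u ≫ p = u := by
    rw [hp, ← Category.assoc, ← Category.assoc, IsIso.hom_inv_id, Category.id_comp]
  rcases isIso_or_isIso_one_sub p with h1 | h1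
  · have hpp : p ≫ p = p := by
      rw [hp]; simp only [Category.assoc]
      rw [← hp, hup]
    have hp1 : p = 𝟙 X := by
      rw [← cancel_epi p, hpp, Category.comp_id]
    refine ⟨v ≫ inv (u ≫ v), ?_, ?_⟩
    · rw [← Category.assoc, IsIso.hom_inv_id]
    · rw [← hp1, hp, Category.assoc]
  · have : u = 0 := by
      rw [← cancel_mono (𝟙 X - p), Preadditive.comp_sub, hup, Category.comp_id, sub_self, zero_comp]
    refine (hZ ((IsZero.iff_id_eq_zero Z).2 ?_)).elim
    rw [← IsIso.hom_inv_id (u ≫ v), Category.assoc]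
    generalize v ≫ inv (u ≫ v) = w
    rw [this, zero_comp]

end Local

theorem isLocalRing_of_iso {X Y : C} (e : X ≅ Y) [IsLocalRing (End X)] : IsLocalRing (End Y) where
  toNontrivial := ⟨1, 0, fun h => not_isZero_of_isLocalRing (X := X)
    (((IsZero.iff_id_eq_zero Y).2 h).of_iso e)⟩
  isUnit_or_isUnit_of_add_one {a b} hab := by
    have key : ∀ c : Y ⟶ Y, IsIso (e.hom ≫ c ≫ e.inv) → IsUnit (show End Y from c) :=
      fun c hc => (isUnit_iff_isIso _).2 <| by
        have : c = e.inv ≫ (e.hom ≫ c ≫ e.inv) ≫ e.hom := by simp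
        rw [this]; infer_instance
    refine Or.imp (key a) (key b) (isIso_or_isIso_of_add (X := X) ?_)
    have hab' : (show Y ⟶ Y from a) + (show Y ⟶ Y from b) = 𝟙 Y := hab
    rw [← Preadditive.comp_add, ← Preadditive.add_comp, hab', Category.id_comp, e.hom_inv_id]
    infer_instance

end Radical

/-! ### Exchange of summands in Krull–Schmidt categories -/

section KrullSchmidt

variable {C : Type u} [Category.{v} C] [Preadditive C] [HasFiniteBiproducts C]

/-- The least number of summands in a decomposition of `X` into objects with local endomorphism
rings. -/
noncomputable def summandCount (X : C) : ℕ :=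
  sInf {m | ∃ Y : Fin m → C, (∀ i, IsLocalRing (End (Y i))) ∧ Nonempty (X ≅ ⨁ Y)}

theorem KrullSchmidt.exists_iso (hKS : KrullSchmidt C) (X : C) :
    ∃ Y : Fin (summandCount X) → C, (∀ i, IsLocalRing (End (Y i))) ∧ Nonempty (X ≅ ⨁ Y) :=
  Nat.sInf_mem (s := {m | ∃ Y : Fin m → C, (∀ i, IsLocalRing (End (Y i))) ∧ Nonempty (X ≅ ⨁ Y)})
    (hKS X)

theorem summandCount_le {X : C} {m : ℕ} (Y : Fin m → C) (hY : ∀ i, IsLocalRing (End (Y i)))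
    (e : X ≅ ⨁ Y) : summandCount X ≤ m :=
  Nat.sInf_le ⟨Y, hY, ⟨e⟩⟩

theorem biproduct_iso_total {X : C} {m : ℕ} {Y : Fin m → C} (e : X ≅ ⨁ Y) :
    ∑ i, (e.hom ≫ biproduct.π Y i) ≫ (biproduct.ι Y i ≫ e.inv) = 𝟙 X := by
  have : ∀ i, (e.hom ≫ biproduct.π Y i) ≫ (biproduct.ι Y i ≫ e.inv) =
      e.hom ≫ (biproduct.π Y i ≫ biproduct.ι Y i) ≫ e.inv := fun i => by simp
  simp_rw [this]
  rw [← Preadditive.comp_sum, ← Preadditive.sum_comp, biproduct.total, Category.id_comp,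
    e.hom_inv_id]

/-- A summand with local endomorphism ring of an object of a Krull-Schmidt category has a
complement with fewer summands. -/
theorem KrullSchmidt.exists_complement (hKS : KrullSchmidt C) {X Z : C}
    (hZ : IsLocalRing (End Z)) (s : Z ⟶ X) (r : X ⟶ Z) (hsr : s ≫ r = 𝟙 Z) :
    ∃ (X' : C) (j : X' ⟶ X) (q : X ⟶ X'), j ≫ q = 𝟙 X' ∧ q ≫ j = 𝟙 X - r ≫ s ∧
      summandCount X' < summandCount X := by
  obtain ⟨Y, hY, ⟨e⟩⟩ := hKS.exists_iso X
  generalize summandCount X = m at *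
  -- The identity of Z is a sum over the summands of X, so one summand contributes an isomorphism; Z
  -- can be exchanged for that summand.
  obtain ⟨i₀, -, hi₀⟩ : ∃ i ∈ Finset.univ,
      IsIso (s ≫ ((e.hom ≫ biproduct.π Y i) ≫ (biproduct.ι Y i ≫ e.inv)) ≫ r) := by
    refine exists_isIso_of_sum Finset.univ _ ?_
    rw [← Preadditive.comp_sum, ← Preadditive.sum_comp, biproduct_iso_total, Category.id_comp, hsr]
    infer_instance
  obtain ⟨m, rfl⟩ : ∃ l, m = l + 1 := ⟨m - 1, by have := i₀.isLt; omega⟩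
  have := hY i₀
  have hu : IsIso (s ≫ e.hom ≫ biproduct.π Y i₀) :=
    isIso_of_isIso_comp_of_isLocalRing not_isZero_of_isLocalRing _
      ((biproduct.ι Y i₀ ≫ e.inv) ≫ r) (by simpa using hi₀)
  set Y' : Fin m → C := fun i => Y (i₀.succAbove i)
  let κ : (⨁ Y') ⟶ X := biproduct.desc fun i => biproduct.ι Y (i₀.succAbove i) ≫ e.inv
  let κ' : X ⟶ ⨁ Y' := biproduct.lift fun i => e.hom ≫ biproduct.π Y (i₀.succAbove i)
  -- A second retraction of `s`, whose kernel is the sum of the remaining summands.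
  let r' : X ⟶ Z := (e.hom ≫ biproduct.π Y i₀) ≫ inv (s ≫ e.hom ≫ biproduct.π Y i₀)
  have hκκ : κ ≫ κ' = 𝟙 _ := by
    ext b a
    simp only [κ, κ', biproduct.ι_desc_assoc, Category.assoc, biproduct.lift_π,
      Iso.inv_hom_id_assoc, Category.id_comp]
    by_cases h : a = b
    · subst h; rw [biproduct.ι_π_self, biproduct.ι_π_self]
    · rw [biproduct.ι_π_ne _ h, biproduct.ι_π_ne _ (fun h' => h (Fin.succAbove_right_injective h'))]
  have hκ'κ : κ' ≫ κ = 𝟙 X - (e.hom ≫ biproduct.π Y i₀) ≫ (biproduct.ι Y i₀ ≫ e.inv) := by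
    rw [← biproduct_iso_total e, Fin.sum_univ_succAbove _ i₀, add_sub_cancel_left]
    simp only [κ, κ', biproduct.lift_desc]
  have hκr : κ ≫ r' = 0 := by
    ext a
    simp only [κ, r', biproduct.ι_desc_assoc, Category.assoc, Iso.inv_hom_id_assoc, comp_zero]
    rw [biproduct.ι_π_ne_assoc _ (Fin.succAbove_ne i₀ a), zero_comp]
  have hsr' : s ≫ r' = 𝟙 Z := by
    simp only [r']
    rw [← Category.assoc, IsIso.hom_inv_id]
  have hπr' : (e.hom ≫ biproduct.π Y i₀) = r' ≫ s ≫ e.hom ≫ biproduct.π Y i₀ := by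
    simp only [r', Category.assoc, IsIso.inv_hom_id, Category.comp_id]
  have key : (𝟙 X - r' ≫ s) ≫ κ' ≫ κ = 𝟙 X - r' ≫ s := by
    rw [hκ'κ, Preadditive.comp_sub, Category.comp_id, sub_eq_self, ← Category.assoc]
    rw [Preadditive.sub_comp, Category.id_comp, Category.assoc r' s, ← hπr', sub_self, zero_comp]
  -- The kernels of `r` and of `r'` are both complements of the image of `s`. Projecting along `s`
  -- identifies them, so the kernel of `r` inherits the m summands of `Y'`.
  refine ⟨⨁ Y', κ ≫ (𝟙 X - r ≫ s), (𝟙 X - r' ≫ s) ≫ κ', ?_, ?_, ?_⟩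
  · have h1 : (𝟙 X - r ≫ s) ≫ (𝟙 X - r' ≫ s) = 𝟙 X - r' ≫ s := by
      simp only [Preadditive.sub_comp, Preadditive.comp_sub, Category.id_comp, Category.comp_id,
        Category.assoc, reassoc_of% hsr']
      abel
    have h2 : κ ≫ (𝟙 X - r' ≫ s) = κ := by
      rw [Preadditive.comp_sub, Category.comp_id, reassoc_of% hκr, zero_comp, sub_zero]
    calc (κ ≫ (𝟙 X - r ≫ s)) ≫ (𝟙 X - r' ≫ s) ≫ κ'
        = κ ≫ ((𝟙 X - r ≫ s) ≫ (𝟙 X - r' ≫ s)) ≫ κ' := by simp only [Category.assoc]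
      _ = 𝟙 _ := by rw [h1, reassoc_of% h2, hκκ]
  · calc ((𝟙 X - r' ≫ s) ≫ κ') ≫ κ ≫ (𝟙 X - r ≫ s)
        = ((𝟙 X - r' ≫ s) ≫ κ' ≫ κ) ≫ (𝟙 X - r ≫ s) := by simp only [Category.assoc]
      _ = 𝟙 X - r ≫ s := by
        rw [key]
        simp only [Preadditive.sub_comp, Preadditive.comp_sub, Category.id_comp, Category.comp_id,
          Category.assoc, reassoc_of% hsr]
        abel
  · exact Nat.lt_succ_of_le (summandCount_le Y' (fun i => hY _) (Iso.refl _))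

/-- Indecomposable objects of a Krull-Schmidt category have local endomorphism rings. -/
theorem KrullSchmidt.isLocalRing_of_indecomposable (hKS : KrullSchmidt C) {X : C}
    (hX : Indecomposable X) : IsLocalRing (End X) := by
  obtain ⟨m, Y, hY, ⟨e⟩⟩ := hKS X
  cases m with
  | zero =>
    refine (hX.1 ((IsZero.iff_id_eq_zero X).2 ?_)).elim
    rw [← biproduct_iso_total e]; simp
  | succ m =>
    have := hY 0
    obtain ⟨X', j, q, hjq, hqj, -⟩ := hKS.exists_complement (hY 0) (biproduct.ι Y 0 ≫ e.inv)
      (e.hom ≫ biproduct.π Y 0) (by simp)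
    have hs : (biproduct.ι Y 0 ≫ e.inv) ≫ (e.hom ≫ biproduct.π Y 0) = 𝟙 _ := by simp
    generalize biproduct.ι Y 0 ≫ e.inv = s at *
    generalize e.hom ≫ biproduct.π Y 0 = r at *
    have hjr : j ≫ r = 0 := by
      have : j ≫ q ≫ j ≫ r = 0 := by
        rw [reassoc_of% hqj]
        simp [hs]
      rwa [reassoc_of% hjq] at this
    have hsq : s ≫ q = 0 := by
      have : s ≫ (q ≫ j) ≫ q = 0 := by
        rw [hqj]
        simp [reassoc_of% hs]
      rwa [Category.assoc, hjq, Category.comp_id] at this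
    let E : X ≅ Y 0 ⊞ X' :=
      { hom := biprod.lift r q
        inv := biprod.desc s j
        hom_inv_id := by rw [biprod.lift_desc, hqj]; abel
        inv_hom_id := by ext <;> simp [hs, hjr, hsq, hjq] }
    rcases hX.2 _ _ E with h | h
    · exact (not_isZero_of_isLocalRing h).elim
    · have hq : q = 0 := h.eq_of_tgt _ _
      rw [hq, zero_comp, eq_comm, sub_eq_zero] at hqj
      exact isLocalRing_of_iso ⟨s, r, hs, hqj.symm⟩

/-- A morphism out of an object of a Krull-Schmidt category which is not radical restricts to an
isomorphism between summands with local endomorphism rings. -/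
theorem KrullSchmidt.exists_of_not_inRadical (hKS : KrullSchmidt C) {X Y : C} {f : X ⟶ Y}
    (hf : ¬ InRadical f) :
    ∃ (Z : C) (_ : IsLocalRing (End Z)) (s : Z ⟶ X) (t : Y ⟶ Z), s ≫ f ≫ t = 𝟙 Z := by
  obtain ⟨m, W, hW, ⟨e⟩⟩ := hKS X
  by_contra hcon
  push Not at hcon
  refine hf ?_
  have : f = ∑ i, (e.hom ≫ biproduct.π W i) ≫ ((biproduct.ι W i ≫ e.inv) ≫ f) := by
    simp_rw [← Category.assoc (e.hom ≫ biproduct.π W _) (biproduct.ι W _ ≫ e.inv) f]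
    rw [← Preadditive.sum_comp, biproduct_iso_total, Category.id_comp]
  rw [this]
  refine InRadical.sum _ fun i _ => InRadical.comp_left ?_ _
  by_contra hi
  have := hW i
  obtain ⟨g, hg⟩ := exists_isIso_comp_of_not_inRadical hi
  exact hcon (W i) this (biproduct.ι W i ≫ e.inv) (g ≫ inv (((biproduct.ι W i ≫ e.inv) ≫ f) ≫ g))
    (by rw [← IsIso.hom_inv_id (((biproduct.ι W i ≫ e.inv) ≫ f) ≫ g)]; simp only [Category.assoc])

end KrullSchmidt

end NExang

namespace NExang

/-! ### Realizations with radical inner differentials -/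

section Reduction

variable {C : Type u} [Category.{v} C] [Preadditive C]

/-- The complex obtained from `K` by splitting off the image of `Φ` degreewise, where `j` and `q`
split the idempotents `1 - Φ`. -/
def splitComplex (K : CochainComplex C ℕ) (Φ : K ⟶ K) (X' : ℕ → C) (j : ∀ m, X' m ⟶ K.X m)
    (q : ∀ m, K.X m ⟶ X' m) (hqj : ∀ m, q m ≫ j m = 𝟙 _ - Φ.f m) : CochainComplex C ℕ where
  X := X'
  d a b := j a ≫ K.d a b ≫ q b
  shape a b h := by simp [K.shape a b h]
  d_comp_d' a b c _ _ := by
    have : K.d a b ≫ (q b ≫ j b) ≫ K.d b c = 0 := by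
      rw [hqj, Preadditive.sub_comp, Preadditive.comp_sub]
      simp
    simp only [Category.assoc] at this ⊢
    rw [reassoc_of% this, zero_comp, comp_zero]

variable (K : CochainComplex C ℕ) (Φ : K ⟶ K) (X' : ℕ → C) (j : ∀ m, X' m ⟶ K.X m)
    (q : ∀ m, K.X m ⟶ X' m) (hjq : ∀ m, j m ≫ q m = 𝟙 _) (hqj : ∀ m, q m ≫ j m = 𝟙 _ - Φ.f m)

/-- If `Φ` is null-homotopic, splitting off its image does not change the homotopy type. -/
def splitHomotopyEquiv (H : Homotopy Φ 0) :
    HomotopyEquiv K (splitComplex K Φ X' j q hqj) where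
  hom :=
    { f := q
      comm' := fun a b _ => by
        have h : q a ≫ j a ≫ K.d a b = K.d a b ≫ q b ≫ j b := by
          rw [← Category.assoc, hqj, hqj]
          simp
        change q a ≫ j a ≫ K.d a b ≫ q b = K.d a b ≫ q b
        rw [reassoc_of% h, hjq, Category.comp_id] }
  inv :=
    { f := j
      comm' := fun a b _ => by
        have h : K.d a b ≫ q b ≫ j b = q a ≫ j a ≫ K.d a b := by
          rw [← Category.assoc (q a), hqj, hqj]
          simp
        change j a ≫ K.d a b = (j a ≫ K.d a b ≫ q b) ≫ j b
        simp only [Category.assoc]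
        rw [h, reassoc_of% hjq] }
  homotopyHomInvId := (Homotopy.equivSubZero.symm ((Homotopy.ofEq (by
    ext m
    change 𝟙 (K.X m) - q m ≫ j m = Φ.f m
    rw [hqj, sub_sub_cancel])).trans H)).symm
  homotopyInvHomId := Homotopy.ofEq (by ext m; exact hjq m)

variable [HasFiniteBiproducts C]

/-- A non-radical inner differential can be removed, up to homotopy equivalence. -/
theorem NComplex.exists_reduction (hKS : KrullSchmidt C) {n : ℕ} {A B : C} (X : NComplex n A B)
    {i : ℕ} (h₁ : 1 ≤ i) (h₂ : i < n) (hi : ¬ InRadical (X.d i)) :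
    ∃ X' : NComplex n A B, X.HtpyEquiv X' ∧
      (∀ m, summandCount (X'.X m) ≤ summandCount (X.X m)) ∧
      summandCount (X'.X i) < summandCount (X.X i) := by
  obtain ⟨Z, hZ, s, t, hst⟩ := hKS.exists_of_not_inRadical hi
  -- Since s ≫ d ≫ t = 1, the complex contains a contractible summand Z = Z in degrees i and i + 1.
  -- The map t ≫ s contracts it, and the resulting null-homotopic Φ is the idempotent projecting
  -- onto it. As 1 ≤ i and i + 1 ≤ n, the end terms are untouched.
  let h : ∀ m, X.X (m + 1) ⟶ X.X m := Pi.single (M := fun m => X.X (m + 1) ⟶ X.X m) i (t ≫ s)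
  let h' : ∀ a b, (ComplexShape.up ℕ).Rel b a → (X.X a ⟶ X.X b) :=
    fun a b (r : b + 1 = a) => by subst r; exact h b
  let Φ : X.cpx ⟶ X.cpx := Homotopy.nullHomotopicMap' h'
  let H : Homotopy Φ 0 := Homotopy.nullHomotopy' h'
  have hΦ0 : Φ.f 0 = X.d 0 ≫ h 0 :=
    Homotopy.nullHomotopicMap'_f_of_not_rel_right (c := ComplexShape.up ℕ) (k₁ := 0) (k₀ := 1)
      rfl (fun l hl => Nat.succ_ne_zero l hl) h'
  have hΦs : ∀ m, Φ.f (m + 1) = X.d (m + 1) ≫ h (m + 1) + h m ≫ X.d m := fun m =>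
    Homotopy.nullHomotopicMap'_f (c := ComplexShape.up ℕ) (k₂ := m) (k₁ := m + 1) (k₀ := m + 2)
      rfl rfl h'
  have hne : ∀ m, m ≠ i → h m = 0 := fun m hm => Pi.single_eq_of_ne hm _
  have heq : h i = t ≫ s := Pi.single_eq_same _ _
  have hΦi : Φ.f i = (X.d i ≫ t) ≫ s := by
    obtain ⟨m, rfl⟩ : ∃ m, i = m + 1 := ⟨i - 1, by omega⟩
    rw [hΦs, hne m (by omega), heq, zero_comp, add_zero, Category.assoc]
  have hΦi' : Φ.f (i + 1) = t ≫ (s ≫ X.d i) := by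
    rw [hΦs, hne (i + 1) (by omega), heq, comp_zero, zero_add, Category.assoc]
  have hΦne : ∀ m, m ≠ i → m ≠ i + 1 → Φ.f m = 0 := fun m hm hm' => by
    cases m with
    | zero => rw [hΦ0, hne 0 hm, comp_zero]
    | succ m =>
      rw [hΦs, hne (m + 1) hm, hne m (by omega), comp_zero, zero_comp, add_zero]
  have hex : ∀ m, ∃ (X' : C) (j : X' ⟶ X.X m) (q : X.X m ⟶ X'), j ≫ q = 𝟙 X' ∧
      q ≫ j = 𝟙 _ - Φ.f m ∧ summandCount X' ≤ summandCount (X.X m) ∧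
      (m = i → summandCount X' < summandCount (X.X m)) := fun m => by
    by_cases hm : m = i
    · subst hm
      obtain ⟨X', j, q, h1, h2, h3⟩ := hKS.exists_complement hZ s (X.d m ≫ t) hst
      exact ⟨X', j, q, h1, by rw [h2, hΦi], h3.le, fun _ => h3⟩
    · by_cases hm' : m = i + 1
      · subst hm'
        obtain ⟨X', j, q, h1, h2, h3⟩ := hKS.exists_complement hZ (s ≫ X.d i) t (by simpa using hst)
        exact ⟨X', j, q, h1, by rw [h2, hΦi'], h3.le, fun h => absurd h hm⟩
      · exact ⟨X.X m, 𝟙 _, 𝟙 _, by simp, by simp [hΦne m hm hm'], le_rfl, fun h => absurd h hm⟩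
  choose X' j q hjq hqj hle hlt using hex
  have hqj1 : ∀ m, m ≠ i → m ≠ i + 1 → q m ≫ j m = 𝟙 _ := fun m hm hm' => by
    rw [hqj, hΦne m hm hm', sub_zero]
  let Y : NComplex n A B :=
    { cpx := splitComplex X.cpx Φ X' j q hqj
      isZero := fun m hm => by
        refine (IsZero.iff_id_eq_zero _).2 ?_
        change 𝟙 (X' m) = 0
        rw [← hjq m, (X.isZero m hm).eq_of_tgt (j m) 0, zero_comp]
      left := Iso.trans ⟨j 0, q 0, hjq 0, hqj1 0 (by omega) (by omega)⟩ X.left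
      right := Iso.trans ⟨j (n + 1), q (n + 1), hjq _, hqj1 _ (by omega) (by omega)⟩ X.right }
  refine ⟨Y, ⟨splitHomotopyEquiv X.cpx Φ X' j q hjq hqj H, ⟨?_, ?_⟩, ⟨?_, ?_⟩⟩, hle, hlt i rfl⟩
  · change X.left.inv ≫ q 0 ≫ j 0 ≫ X.left.hom = 𝟙 A
    rw [reassoc_of% hqj1 0 (by omega) (by omega), X.left.inv_hom_id]
  · change X.right.inv ≫ q (n + 1) ≫ j (n + 1) ≫ X.right.hom = 𝟙 B
    rw [reassoc_of% hqj1 (n + 1) (by omega) (by omega), X.right.inv_hom_id]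
  · change (X.left.inv ≫ q 0) ≫ j 0 ≫ X.left.hom = 𝟙 A
    rw [Category.assoc, reassoc_of% hqj1 0 (by omega) (by omega), X.left.inv_hom_id]
  · change (X.right.inv ≫ q (n + 1)) ≫ j (n + 1) ≫ X.right.hom = 𝟙 B
    rw [Category.assoc, reassoc_of% hqj1 (n + 1) (by omega) (by omega), X.right.inv_hom_id]

/-- In a Krull-Schmidt category every complex with fixed end terms is homotopy equivalent to one
with radical inner differentials. -/
theorem NComplex.exists_inRadical (hKS : KrullSchmidt C) {n : ℕ} {A B : C} (X : NComplex n A B) :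
    ∃ X' : NComplex n A B, X.HtpyEquiv X' ∧ ∀ i, 1 ≤ i → i < n → InRadical (X'.d i) := by
  induction hN : ∑ m ∈ Finset.range n, summandCount (X.X m) using Nat.strong_induction_on
    generalizing X with
  | _ N ih =>
    by_cases hX : ∀ i, 1 ≤ i → i < n → InRadical (X.d i)
    · exact ⟨X, (NComplex.setoid n A B).refl X, hX⟩
    · push Not at hX
      obtain ⟨i, h₁, h₂, hi⟩ := hX
      obtain ⟨Y, hXY, hle, hlt⟩ := X.exists_reduction hKS h₁ h₂ hi
      -- Degree n may be left out of the count: a reduction at i < n already lowers the number of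
      -- summands in degree i.
      obtain ⟨X', hYX', hX'⟩ := ih _ (hN ▸ Finset.sum_lt_sum (fun m _ => hle m)
        ⟨i, Finset.mem_range.2 h₂, hlt⟩) Y rfl
      exact ⟨X', (NComplex.setoid n A B).trans hXY hYX', hX'⟩

end Reduction

end NExang

namespace NExang

noncomputable section

variable {k : Type uk} [CommRing k] {C : Type u} [Category.{v} C] [Preadditive C] [Linear k C]

/-! ### Calculus of extensions, essential and minimal extensions -/

namespace ExtBifunctor

variable (E : ExtBifunctor.{w} k C)

theorem push_id {B A : C} (δ : E.Ext B A) : E.push (𝟙 A) δ = δ := by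
  simp [push]

theorem push_comp {B A A' A'' : C} (a : A ⟶ A') (a' : A' ⟶ A'') (δ : E.Ext B A) :
    E.push (a ≫ a') δ = E.push a' (E.push a δ) := by
  simp [push]

theorem pull_id {B A : C} (δ : E.Ext B A) : E.pull (𝟙 B) δ = δ := by
  simp [pull]

theorem pull_comp {B B' B'' A : C} (c : B' ⟶ B) (c' : B'' ⟶ B') (δ : E.Ext B A) :
    E.pull (c' ≫ c) δ = E.pull c' (E.pull c δ) := by
  simp [pull]

theorem push_pull {B B' A A' : C} (a : A ⟶ A') (c : B' ⟶ B) (δ : E.Ext B A) :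
    E.push a (E.pull c δ) = E.pull c (E.push a δ) :=
  (ConcreteCategory.congr_hom ((E.functor.map c.op).naturality a) δ).symm

theorem push_add {B A A' : C} (a a' : A ⟶ A') (δ : E.Ext B A) :
    E.push (a + a') δ = E.push a δ + E.push a' δ := by
  simp [push, E.map_add_right]

theorem push_smul {B A A' : C} (r : k) (a : A ⟶ A') (δ : E.Ext B A) :
    E.push (r • a) δ = r • E.push a δ := by
  simp [push, E.map_smul_right]

theorem pull_add {B B' A : C} (c c' : B' ⟶ B) (δ : E.Ext B A) :
    E.pull (c + c') δ = E.pull c δ + E.pull c' δ := by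
  rw [pull, E.map_add_left]; rfl

theorem pull_smul {B B' A : C} (r : k) (c : B' ⟶ B) (δ : E.Ext B A) :
    E.pull (r • c) δ = r • E.pull c δ := by
  simp [pull, E.map_smul_left]

/-- `E.push a δ` as a linear map in `a`. -/
def pushHom {B A : C} (A' : C) (δ : E.Ext B A) : (A ⟶ A') →ₗ[k] E.Ext B A' where
  toFun a := E.push a δ
  map_add' a a' := E.push_add a a' δ
  map_smul' r a := E.push_smul r a δ

/-- `E.pull c δ` as a linear map in `c`. -/
def pullHom {B A : C} (B' : C) (δ : E.Ext B A) : (B' ⟶ B) →ₗ[k] E.Ext B' A where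
  toFun c := E.pull c δ
  map_add' c c' := E.pull_add c c' δ
  map_smul' r c := E.pull_smul r c δ

theorem push_zero {B A A' : C} (δ : E.Ext B A) : E.push (0 : A ⟶ A') δ = 0 :=
  (E.pushHom A' δ).map_zero

theorem pull_zero {B B' A : C} (δ : E.Ext B A) : E.pull (0 : B' ⟶ B) δ = 0 :=
  (E.pullHom B' δ).map_zero

theorem push_sub {B A A' : C} (a a' : A ⟶ A') (δ : E.Ext B A) :
    E.push (a - a') δ = E.push a δ - E.push a' δ :=
  (E.pushHom A' δ).map_sub a a'

theorem pull_sub {B B' A : C} (c c' : B' ⟶ B) (δ : E.Ext B A) :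
    E.pull (c - c') δ = E.pull c δ - E.pull c' δ :=
  (E.pullHom B' δ).map_sub c c'

theorem push_sum {B A A' : C} {ι : Type*} (s : Finset ι) (a : ι → (A ⟶ A')) (δ : E.Ext B A) :
    E.push (∑ i ∈ s, a i) δ = ∑ i ∈ s, E.push (a i) δ :=
  map_sum (E.pushHom A' δ) a s

theorem pull_sum {B B' A : C} {ι : Type*} (s : Finset ι) (c : ι → (B' ⟶ B)) (δ : E.Ext B A) :
    E.pull (∑ i ∈ s, c i) δ = ∑ i ∈ s, E.pull (c i) δ :=
  map_sum (E.pullHom B' δ) c s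

theorem eq_zero_of_push {B A A' : C} {a : A ⟶ A'} (ha : IsSplitMono a) {δ : E.Ext B A}
    (h : E.push a δ = 0) : δ = 0 := by
  rw [← E.push_id δ, ← IsSplitMono.id a, push_comp, h, map_zero]

theorem eq_zero_of_pull {B B' A : C} {c : B' ⟶ B} (hc : IsSplitEpi c) {δ : E.Ext B A}
    (h : E.pull c δ = 0) : δ = 0 := by
  rw [← E.pull_id δ, ← IsSplitEpi.id c, pull_comp, h, map_zero]

/-- The endomorphism 1 - a ≫ b kills δ ≠ 0, so it is not invertible; locality makes a ≫ b
invertible. -/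
theorem isSplitMono_of_push_push {A A' B : C} (hA : IsLocalRing (End A)) {δ : E.Ext B A}
    (hδ : δ ≠ 0) (a : A ⟶ A') (b : A' ⟶ A) (h : E.push b (E.push a δ) = δ) : IsSplitMono a := by
  refine isSplitMono_of_isIso_comp a b
    ((isIso_or_isIso_one_sub (a ≫ b)).resolve_right fun h1 => hδ ?_)
  refine E.eq_zero_of_push (a := 𝟙 A - a ≫ b) inferInstance ?_
  rw [push_sub, push_id, push_comp, h, sub_self]

theorem isSplitEpi_of_pull_pull {A B B' : C} (hB : IsLocalRing (End B)) {δ : E.Ext B A}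
    (hδ : δ ≠ 0) (c : B' ⟶ B) (b : B ⟶ B') (h : E.pull b (E.pull c δ) = δ) : IsSplitEpi c := by
  refine isSplitEpi_of_isIso_comp c b
    ((isIso_or_isIso_one_sub (b ≫ c)).resolve_right fun h1 => hδ ?_)
  refine E.eq_zero_of_pull (c := 𝟙 B - b ≫ c) inferInstance ?_
  rw [pull_sub, pull_id, pull_comp, h, sub_self]

/-- Every nonzero extension of `B` can be pushed out to `δ`. -/
def PushEssential {B A : C} (δ : E.Ext B A) : Prop :=
  ∀ ⦃T : C⦄ (ζ : E.Ext B T), ζ ≠ 0 → ∃ g : T ⟶ A, E.push g ζ = δ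

/-- Every nonzero extension by `A` can be pulled back to `δ`. -/
def PullEssential {B A : C} (δ : E.Ext B A) : Prop :=
  ∀ ⦃Z : C⦄ (ξ : E.Ext Z A), ξ ≠ 0 → ∃ c : B ⟶ Z, E.pull c ξ = δ

/-- Every nonzero push-out of `δ` can be pushed out to `δ` again. -/
def PushReversible {B A : C} (δ : E.Ext B A) : Prop :=
  ∀ ⦃T : C⦄ (g : A ⟶ T), E.push g δ ≠ 0 → ∃ h : T ⟶ A, E.push h (E.push g δ) = δ

variable {E}

theorem PushEssential.pushReversible {B A : C} {δ : E.Ext B A} (h : E.PushEssential δ) :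
    E.PushReversible δ := fun _ g hg => h (E.push g δ) hg

theorem PushEssential.push {B A A' : C} {δ : E.Ext B A} (h : E.PushEssential δ) (a : A ⟶ A') :
    E.PushEssential (E.push a δ) := fun T ζ hζ => by
  obtain ⟨g, rfl⟩ := h ζ hζ
  exact ⟨g ≫ a, E.push_comp _ _ _⟩

theorem PushReversible.push_eq_zero {A A' B : C} (hA : IsLocalRing (End A)) {δ : E.Ext B A}
    (hδ : δ ≠ 0) (h : E.PushReversible δ) {a : A ⟶ A'} (ha : ¬ IsSplitMono a) :
    E.push a δ = 0 := by
  by_contra h0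
  obtain ⟨b, hb⟩ := h a h0
  exact ha (E.isSplitMono_of_push_push hA hδ a b hb)

theorem PullEssential.pull_eq_zero {A B B' : C} (hB : IsLocalRing (End B)) {δ : E.Ext B A}
    (hδ : δ ≠ 0) (h : E.PullEssential δ) {c : B' ⟶ B} (hc : ¬ IsSplitEpi c) :
    E.pull c δ = 0 := by
  by_contra h0
  obtain ⟨b, hb⟩ := h _ h0
  exact hc (E.isSplitEpi_of_pull_pull hB hδ c b hb)

section

variable [HasFiniteBiproducts C]

/-- A nonzero extension has a nonzero component at a summand with local endomorphism ring. -/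
theorem exists_push_ne_zero (hKS : KrullSchmidt C) {A B : C} {δ : E.Ext B A} (hδ : δ ≠ 0) :
    ∃ (A' : C) (_ : IsLocalRing (End A')) (p : A ⟶ A') (s : A' ⟶ A), s ≫ p = 𝟙 A' ∧
      E.push p δ ≠ 0 := by
  obtain ⟨m, Y, hY, ⟨e⟩⟩ := hKS A
  by_contra hcon
  push Not at hcon
  refine hδ ?_
  rw [← E.push_id δ, ← biproduct_iso_total e, push_sum]
  refine Finset.sum_eq_zero fun i _ => ?_
  rw [push_comp, hcon (Y i) (hY i) (e.hom ≫ biproduct.π Y i) (biproduct.ι Y i ≫ e.inv) (by simp),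
    map_zero]

/-- Reversibility survives projection to a summand: if `b` brings a push-out back to δ, then b ≫ p
brings it back to the component of δ. -/
theorem PushReversible.exists_local (hKS : KrullSchmidt C) {A B : C} {δ : E.Ext B A} (hδ : δ ≠ 0)
    (h : E.PushReversible δ) :
    ∃ (A' : C) (_ : IsLocalRing (End A')) (p : A ⟶ A'), E.push p δ ≠ 0 ∧
      E.PushReversible (E.push p δ) := by
  obtain ⟨A', hA', p, s, -, hp⟩ := exists_push_ne_zero hKS hδ
  refine ⟨A', hA', p, hp, fun T g hg => ?_⟩
  rw [← push_comp] at hg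
  obtain ⟨b, hb⟩ := h _ hg
  exact ⟨b ≫ p, by rw [push_comp, ← E.push_comp p g, hb]⟩

end

/-- Among the extensions in a nonzero `End A`-stable set there is a minimal one. -/
theorem exists_push_minimal [IsArtinianRing k] {B A : C} [Module.Finite k (E.Ext B A)]
    (F : Set (E.Ext B A)) (hF : ∀ ζ ∈ F, ∀ a : A ⟶ A, E.push a ζ ∈ F) (hne : ∃ ζ ∈ F, ζ ≠ 0) :
    ∃ ζ ∈ F, ζ ≠ 0 ∧ ∀ a : A ⟶ A, E.push a ζ ≠ 0 → ∃ b : A ⟶ A, E.push b (E.push a ζ) = ζ := by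
  -- The End A-submodule generated by ζ is a `k`-submodule of an artinian module, so a minimal one
  -- exists among nonzero ζ in F. A nonzero push-out of such a ζ generates the same submodule.
  let r : {ζ // ζ ∈ F ∧ ζ ≠ 0} → Submodule k (E.Ext B A) := fun ζ =>
    LinearMap.range (E.pushHom A ζ.1)
  obtain ⟨ζ₀, h0, h0'⟩ := hne
  have : Nonempty {ζ // ζ ∈ F ∧ ζ ≠ 0} := ⟨⟨ζ₀, h0, h0'⟩⟩
  obtain ⟨ζ, hζ⟩ := exists_minimalFor_of_wellFoundedLT (fun _ => True) r ⟨Classical.arbitrary _, trivial⟩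
  refine ⟨ζ.1, ζ.2.1, ζ.2.2, fun a ha => ?_⟩
  have hle : r ⟨E.push a ζ.1, hF _ ζ.2.1 a, ha⟩ ≤ r ζ := by
    rintro _ ⟨b, rfl⟩
    exact ⟨a ≫ b, E.push_comp _ _ _⟩
  obtain ⟨b, hb⟩ := hζ.2 (j := ⟨E.push a ζ.1, hF _ ζ.2.1 a, ha⟩) trivial hle
    ⟨𝟙 A, E.push_id ζ.1⟩
  exact ⟨b, hb⟩

/-- Among the extensions in a nonzero `End B`-stable set there is a minimal one. -/
theorem exists_pull_minimal [IsArtinianRing k] {B A : C} [Module.Finite k (E.Ext B A)]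
    (F : Set (E.Ext B A)) (hF : ∀ ζ ∈ F, ∀ c : B ⟶ B, E.pull c ζ ∈ F) (hne : ∃ ζ ∈ F, ζ ≠ 0) :
    ∃ ζ ∈ F, ζ ≠ 0 ∧ ∀ c : B ⟶ B, E.pull c ζ ≠ 0 → ∃ b : B ⟶ B, E.pull b (E.pull c ζ) = ζ := by
  let r : {ζ // ζ ∈ F ∧ ζ ≠ 0} → Submodule k (E.Ext B A) := fun ζ =>
    LinearMap.range (E.pullHom B ζ.1)
  obtain ⟨ζ₀, h0, h0'⟩ := hne
  have : Nonempty {ζ // ζ ∈ F ∧ ζ ≠ 0} := ⟨⟨ζ₀, h0, h0'⟩⟩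
  obtain ⟨ζ, hζ⟩ := exists_minimalFor_of_wellFoundedLT (fun _ => True) r ⟨Classical.arbitrary _, trivial⟩
  refine ⟨ζ.1, ζ.2.1, ζ.2.2, fun c hc => ?_⟩
  have hle : r ⟨E.pull c ζ.1, hF _ ζ.2.1 c, hc⟩ ≤ r ζ := by
    rintro _ ⟨b, rfl⟩
    exact ⟨b ≫ c, E.pull_comp _ _ _⟩
  obtain ⟨b, hb⟩ := hζ.2 (j := ⟨E.pull c ζ.1, hF _ ζ.2.1 c, hc⟩) trivial hle
    ⟨𝟙 B, E.pull_id ζ.1⟩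
  exact ⟨b, hb⟩

end ExtBifunctor

/-! ### Long exact sequences of a distinguished n-exangle -/

namespace NExangulated

variable [HasFiniteBiproducts C] {n : ℕ} (𝓒 : NExangulated.{w} k C n)

theorem exists_distinguished {A B : C} (δ : 𝓒.E.Ext B A) :
    ∃ X : NComplex n A B, 𝓒.Distinguished X δ := by
  obtain ⟨X, hX⟩ := Quotient.exists_rep (𝓒.s δ)
  exact ⟨X, hX.symm⟩

variable {𝓒}

theorem factorsThrough_dLast_iff {A B : C} {δ : 𝓒.E.Ext B A} {X : NComplex n A B}
    (hX : 𝓒.Distinguished X δ) {T : C} (g : T ⟶ B) :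
    FactorsThrough g X.dLast ↔ 𝓒.E.pull g δ = 0 := by
  refine ⟨?_, fun h => (𝓒.exact.R1 δ X hX).exact_right_last g h⟩
  rintro ⟨s, rfl⟩
  rw [ExtBifunctor.pull_comp, (𝓒.exact.R1 δ X hX).pull_dLast, map_zero]

theorem cofactorsThrough_dFirst_iff {A B : C} {δ : 𝓒.E.Ext B A} {X : NComplex n A B}
    (hX : 𝓒.Distinguished X δ) {T : C} (g : A ⟶ T) :
    CofactorsThrough g X.dFirst ↔ 𝓒.E.push g δ = 0 := by
  refine ⟨?_, fun h => (𝓒.exact.R1 δ X hX).exact_left_first g h⟩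
  rintro ⟨s, rfl⟩
  rw [ExtBifunctor.push_comp, (𝓒.exact.R1 δ X hX).push_dFirst, map_zero]

theorem isSplitEpi_dLast_iff {A B : C} {δ : 𝓒.E.Ext B A} {X : NComplex n A B}
    (hX : 𝓒.Distinguished X δ) : IsSplitEpi X.dLast ↔ δ = 0 := by
  rw [← 𝓒.E.pull_id δ, ← factorsThrough_dLast_iff hX]
  exact ⟨fun h => ⟨section_ X.dLast, IsSplitEpi.id _⟩, fun ⟨s, hs⟩ => IsSplitEpi.mk' ⟨s, hs⟩⟩

theorem isSplitMono_dFirst_iff {A B : C} {δ : 𝓒.E.Ext B A} {X : NComplex n A B}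
    (hX : 𝓒.Distinguished X δ) : IsSplitMono X.dFirst ↔ δ = 0 := by
  rw [← 𝓒.E.push_id δ, ← cofactorsThrough_dFirst_iff hX]
  exact ⟨fun h => ⟨retraction X.dFirst, IsSplitMono.id _⟩,
    fun ⟨s, hs⟩ => IsSplitMono.mk' ⟨s, hs⟩⟩

/-- Exactness of `C(-, B) ⟶ 𝔼(-, A) ⟶ 𝔼(-, X₁)`. -/
theorem exists_pull_eq (hn : 1 ≤ n) {A B : C} {δ : 𝓒.E.Ext B A} {X : NComplex n A B}
    (hX : 𝓒.Distinguished X δ) {T : C} (θ : 𝓒.E.Ext T A) (hθ : 𝓒.E.push X.dFirst θ = 0) :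
    ∃ c : T ⟶ B, 𝓒.E.pull c δ = θ := by
  -- The extension with components δ and θ. Applying (EA2) to the inclusion of B gives a mapping
  -- cone realizing the push-out of ρ along `X.dFirst`, which vanishes; the cone therefore splits at
  -- its end.
  let ρ : 𝓒.E.Ext (B ⊞ T) A := 𝓒.E.pull biprod.fst δ + 𝓒.E.pull biprod.snd θ
  have h1 : 𝓒.E.pull biprod.inl ρ = δ := by
    rw [map_add, ← ExtBifunctor.pull_comp, ← ExtBifunctor.pull_comp, biprod.inl_fst,
      biprod.inl_snd, ExtBifunctor.pull_id, ExtBifunctor.pull_zero, add_zero]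
  have h2 : 𝓒.E.pull biprod.inr ρ = θ := by
    rw [map_add, ← ExtBifunctor.pull_comp, ← ExtBifunctor.pull_comp, biprod.inr_fst,
      biprod.inr_snd, ExtBifunctor.pull_id, ExtBifunctor.pull_zero, zero_add]
  obtain ⟨Y, hY⟩ := 𝓒.exists_distinguished ρ
  obtain ⟨f, hf, M, e, hM, hMρ⟩ := 𝓒.EA2 ρ biprod.inl X Y (h1.symm ▸ hX) hY
  have h0 : 𝓒.E.push X.dFirst ρ = 0 := by
    rw [map_add, ExtBifunctor.push_pull, ExtBifunctor.push_pull, hθ,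
      (𝓒.exact.R1 δ X hX).push_dFirst, map_zero, map_zero, add_zero]
  rw [h0] at hMρ
  have hsplit := (isSplitEpi_dLast_iff hMρ).2 rfl
  have hlast := hM.last hn
  let s := section_ M.dLast ≫ (e n hn le_rfl).hom
  have hs : s ≫ biprod.desc (f.f (n + 1) ≫ Y.right.hom) Y.dLast = 𝟙 (B ⊞ T) := by
    rw [← hlast]
    simp only [s, Category.assoc, Iso.hom_inv_id_assoc]
    exact IsSplitEpi.id _
  have hf' : f.f (n + 1) ≫ Y.right.hom = X.right.hom ≫ biprod.inl := by
    rw [← hf.right, Iso.hom_inv_id_assoc]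
  refine ⟨biprod.inr ≫ s ≫ biprod.fst ≫ X.right.hom, ?_⟩
  -- The section writes the inclusion of T as a map through B plus a map through `Y.dLast`. Pulling
  -- ρ back along both sides kills the second term and leaves θ = c^* δ.
  have hs' : biprod.inr = (biprod.inr ≫ s ≫ biprod.fst ≫ X.right.hom) ≫ biprod.inl +
      (biprod.inr ≫ s ≫ biprod.snd) ≫ Y.dLast := by
    conv_lhs => rw [← Category.comp_id biprod.inr, ← hs, hf', biprod.desc_eq]
    simp only [Preadditive.comp_add, Category.assoc]
  generalize biprod.inr ≫ s ≫ biprod.fst ≫ X.right.hom = c at hs' ⊢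
  conv_rhs => rw [← h2, hs']
  rw [ExtBifunctor.pull_add, ExtBifunctor.pull_comp _ biprod.inl, h1,
    ExtBifunctor.pull_comp _ Y.dLast, (𝓒.exact.R1 ρ Y hY).pull_dLast, map_zero, add_zero]

/-- Exactness of `C(A, -) ⟶ 𝔼(B, -) ⟶ 𝔼(Xₙ, -)`. -/
theorem exists_push_eq (hn : 1 ≤ n) {A B : C} {δ : 𝓒.E.Ext B A} {X : NComplex n A B}
    (hX : 𝓒.Distinguished X δ) {T : C} (θ : 𝓒.E.Ext B T) (hθ : 𝓒.E.pull X.dLast θ = 0) :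
    ∃ a : A ⟶ T, 𝓒.E.push a δ = θ := by
  -- Dual construction: the mapping cocone from (EA2^op) realizes the pull-back of ρ along
  -- `X.dLast`, which is zero, so it splits at its start.
  let ρ : 𝓒.E.Ext B (A ⊞ T) := 𝓒.E.push biprod.inl δ + 𝓒.E.push biprod.inr θ
  have h1 : 𝓒.E.push biprod.fst ρ = δ := by
    rw [map_add, ← ExtBifunctor.push_comp, ← ExtBifunctor.push_comp, biprod.inl_fst,
      biprod.inr_fst, ExtBifunctor.push_id, ExtBifunctor.push_zero, add_zero]
  have h2 : 𝓒.E.push biprod.snd ρ = θ := by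
    rw [map_add, ← ExtBifunctor.push_comp, ← ExtBifunctor.push_comp, biprod.inl_snd,
      biprod.inr_snd, ExtBifunctor.push_id, ExtBifunctor.push_zero, zero_add]
  obtain ⟨Y, hY⟩ := 𝓒.exists_distinguished ρ
  obtain ⟨f, hf, N, e, hN, hNρ⟩ := 𝓒.EA2_op ρ biprod.fst Y X hY (h1.symm ▸ hX)
  have h0 : 𝓒.E.pull X.dLast ρ = 0 := by
    rw [map_add, ← ExtBifunctor.push_pull, ← ExtBifunctor.push_pull, hθ,
      (𝓒.exact.R1 δ X hX).pull_dLast, map_zero, map_zero, add_zero]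
  rw [h0] at hNρ
  have hsplit := (isSplitMono_dFirst_iff hNρ).2 rfl
  have hfirst := hN.first hn
  let r := (e 1 le_rfl hn).inv ≫ retraction N.dFirst
  have hr : biprod.lift Y.dFirst (Y.left.inv ≫ f.f 0) ≫ r = 𝟙 (A ⊞ T) := by
    rw [← hfirst]
    simp only [r, Category.assoc, Iso.hom_inv_id_assoc]
    exact IsSplitMono.id _
  have hf' : Y.left.inv ≫ f.f 0 = biprod.fst ≫ X.left.inv := by
    rw [← hf.left]; simp
  refine ⟨X.left.inv ≫ biprod.inr ≫ r ≫ biprod.snd, ?_⟩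
  have hr' : biprod.snd = Y.dFirst ≫ biprod.inl ≫ r ≫ biprod.snd +
      biprod.fst ≫ (X.left.inv ≫ biprod.inr ≫ r ≫ biprod.snd) := by
    conv_lhs => rw [← Category.id_comp biprod.snd, ← hr, hf', biprod.lift_eq]
    simp only [Preadditive.add_comp, Category.assoc]
  generalize X.left.inv ≫ biprod.inr ≫ r ≫ biprod.snd = a at hr' ⊢
  conv_rhs => rw [← h2, hr']
  rw [ExtBifunctor.push_add, ExtBifunctor.push_comp _ biprod.fst, h1,
    ExtBifunctor.push_comp _ Y.dFirst, (𝓒.exact.R1 ρ Y hY).push_dFirst, map_zero, zero_add]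

/-- The deflation realizing a nonzero ζ is not a split epimorphism, so it kills δ; exactness then
exhibits δ as a push-out of ζ. -/
theorem pushEssential_of_pull_eq_zero (hn : 1 ≤ n) {A B : C} {δ : 𝓒.E.Ext B A}
    (h : ∀ ⦃L : C⦄ (c : L ⟶ B), ¬ IsSplitEpi c → 𝓒.E.pull c δ = 0) : 𝓒.E.PushEssential δ :=
  fun T ζ hζ => by
    obtain ⟨X, hX⟩ := 𝓒.exists_distinguished ζ
    exact exists_push_eq hn hX δ (h _ (mt (isSplitEpi_dLast_iff hX).1 hζ))

theorem pullEssential_of_push_eq_zero (hn : 1 ≤ n) {A B : C} {δ : 𝓒.E.Ext B A}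
    (h : ∀ ⦃L : C⦄ (a : A ⟶ L), ¬ IsSplitMono a → 𝓒.E.push a δ = 0) : 𝓒.E.PullEssential δ :=
  fun Z ξ hξ => by
    obtain ⟨X, hX⟩ := 𝓒.exists_distinguished ξ
    exact exists_pull_eq hn hX δ (h _ (mt (isSplitMono_dFirst_iff hX).1 hξ))

/-- Every extension has a distinguished realization with radical inner differentials. -/
theorem exists_distinguished_inRadical (hKS : KrullSchmidt C) {A B : C} (δ : 𝓒.E.Ext B A) :
    ∃ X : NComplex n A B, 𝓒.Distinguished X δ ∧ ∀ i, 1 ≤ i → i < n → InRadical (X.d i) := by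
  obtain ⟨X, hX⟩ := 𝓒.exists_distinguished δ
  obtain ⟨X', hXX', h⟩ := X.exists_inRadical hKS
  exact ⟨X', hX.trans (Quotient.sound hXX'), h⟩

theorem ext_eq_zero_of_isProjective {P : C} (hP : 𝓒.IsProjective P) {Z : C} (ζ : 𝓒.E.Ext P Z) :
    ζ = 0 := by
  obtain ⟨X, hX⟩ := 𝓒.exists_distinguished ζ
  rw [← 𝓒.E.pull_id ζ]
  exact (factorsThrough_dLast_iff hX _).1 (hP ζ X hX (𝟙 P))

theorem isProjective_of_ext_eq_zero {P : C} (hP : ∀ (Z : C) (ζ : 𝓒.E.Ext P Z), ζ = 0) :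
    𝓒.IsProjective P := fun _ _ _ _ hX c => (factorsThrough_dLast_iff hX c).2 (hP _ _)

end NExangulated

end

end NExang

namespace NExang

section

variable {k : Type uk} [CommRing k] {C : Type u} [Category.{v} C] [Preadditive C] [Linear k C]
  [HasFiniteBiproducts C] {n : ℕ} {𝓒 : NExangulated.{w} k C n}
  {Q : Type uk} [AddCommGroup Q] [Module k Q]

/-! ### Representability of D 𝔼(X, -) through dualizing functionals -/

namespace NExangulated

/-- The functional `φ` on `𝔼(X, A)` exhibits `A` as a representing object of `D 𝔼(X, -)` on the
costable category. -/
structure IsDualizing {X A : C} (φ : 𝓒.E.Ext X A →ₗ[k] Q) : Prop where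
  injTrivial : ∀ ⦃T : C⦄ (g : T ⟶ A), (∀ ζ : 𝓒.E.Ext X T, φ (𝓒.E.push g ζ) = 0) →
    𝓒.InjTrivial g
  exists_eq : ∀ ⦃T : C⦄ (ψ : 𝓒.E.Ext X T →ₗ[k] Q),
    ∃ g : T ⟶ A, ∀ ζ, ψ ζ = φ (𝓒.E.push g ζ)

/-- Yoneda: φ is the universal element of the representation. The two fields of `IsDualizing` are
injectivity, modulo injectively trivial morphisms, and surjectivity of the map it induces. -/
theorem inCr_iff (X : C) :
    𝓒.InCr Q X ↔ ∃ (A : C) (φ : 𝓒.E.Ext X A →ₗ[k] Q), IsDualizing φ := by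
  let q := CategoryTheory.Quotient.functor 𝓒.costableRel
  constructor
  · rintro ⟨⟨A⟩, ⟨R⟩⟩
    let φ : 𝓒.E.Ext X A →ₗ[k] Q := R.homEquiv (𝟙 (q.obj A))
    have key : ∀ ⦃T : C⦄ (g : T ⟶ A), (R.homEquiv (q.map g) : 𝓒.E.Ext X T →ₗ[k] Q) =
        φ ∘ₗ 𝓒.E.push g := fun T g => by
      have := R.homEquiv_comp (q.map g) (𝟙 (q.obj A))
      rw [Category.comp_id] at this
      exact this
    refine ⟨A, φ, fun T g hg => ?_, fun T ψ => ?_⟩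
    · have h0 : q.map g = q.map 0 := R.homEquiv.injective <| by
        refine (key g).trans (Eq.trans ?_ (key 0).symm)
        change φ ∘ₗ 𝓒.E.push g = φ ∘ₗ 𝓒.E.push 0
        refine LinearMap.ext fun ζ => ?_
        rw [LinearMap.comp_apply, hg, LinearMap.comp_apply, ExtBifunctor.push_zero, map_zero]
      have := (CategoryTheory.Quotient.functor_map_eq_iff _ _ _).1 h0
      change 𝓒.InjTrivial (g - 0) at this
      rwa [sub_zero] at this
    · obtain ⟨g, hg⟩ := q.map_surjective (R.homEquiv.symm ψ : q.obj T ⟶ q.obj A)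
      refine ⟨g, fun ζ => ?_⟩
      have h1 := key g
      rw [hg] at h1
      exact LinearMap.congr_fun ((R.homEquiv.apply_symm_apply ψ).symm.trans h1) ζ
  · rintro ⟨A, φ, hφ⟩
    let F := 𝓒.dualExt Q X ⋙ forget (ModuleCat k)
    let φ' : F.obj (op (q.obj A)) := φ
    refine ⟨q.obj A, ⟨⟨fun {T} => Equiv.ofBijective (fun f => F.map f.op φ') ⟨?_, ?_⟩, ?_⟩⟩⟩
    · intro f g hfg
      obtain ⟨T⟩ := T
      obtain ⟨f, rfl⟩ := q.map_surjective (X := T) (Y := A) f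
      obtain ⟨g, rfl⟩ := q.map_surjective (X := T) (Y := A) g
      refine (CategoryTheory.Quotient.functor_map_eq_iff _ _ _).2 (hφ.injTrivial _ fun ζ => ?_)
      have : φ (𝓒.E.push f ζ) = φ (𝓒.E.push g ζ) :=
        LinearMap.congr_fun (show φ ∘ₗ 𝓒.E.push f = φ ∘ₗ 𝓒.E.push g from hfg) ζ
      rw [ExtBifunctor.push_sub, map_sub, this, sub_self]
    · intro ψ
      obtain ⟨T⟩ := T
      obtain ⟨g, hg⟩ := hφ.exists_eq (T := T) ψ
      exact ⟨q.map g, LinearMap.ext fun ζ => (hg ζ).symm⟩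
    · intro T T' f g
      simp [F]

/-- The pairing of morphisms `T ⟶ A` with extensions in `𝔼(X, T)` given by a functional on
`𝔼(X, A)`. -/
def pushPairing {X A : C} (φ : 𝓒.E.Ext X A →ₗ[k] Q) (T : C) :
    (T ⟶ A) →ₗ[k] 𝓒.E.Ext X T →ₗ[k] Q where
  toFun g := φ ∘ₗ 𝓒.E.push g
  map_add' a b := by ext ζ; simp [ExtBifunctor.push_add]
  map_smul' r a := by ext ζ; simp [ExtBifunctor.push_smul]

/-- The pairing of morphisms `X ⟶ Y` with extensions in `𝔼(Y, A)` given by a functional on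
`𝔼(X, A)`. -/
def pullPairing {X A : C} (φ : 𝓒.E.Ext X A →ₗ[k] Q) (Y : C) :
    (X ⟶ Y) →ₗ[k] 𝓒.E.Ext Y A →ₗ[k] Q where
  toFun c := φ ∘ₗ 𝓒.E.pull c
  map_add' a b := by ext ζ; simp [ExtBifunctor.pull_add]
  map_smul' r a := by ext ζ; simp [ExtBifunctor.pull_smul]

variable [IsArtinianRing k]

/-- A functional not vanishing on an extension that is essential on both sides is dualizing. -/
theorem exists_isDualizing_of_essential (hQ : IsMinimalInjectiveCogenerator k Q)
    (hfin : 𝓒.ExtFinite) {X A : C} {δ : 𝓒.E.Ext X A} (hδ : δ ≠ 0) (h₁ : 𝓒.E.PushEssential δ)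
    (h₂ : 𝓒.E.PullEssential δ) : ∃ φ : 𝓒.E.Ext X A →ₗ[k] Q, IsDualizing φ := by
  -- Any φ with φ(δ) ≠ 0 works: a nonzero extension can be moved to δ by a push-out or a pull-back,
  -- so no pairing defined by φ can annihilate it.
  obtain ⟨φ, hφ⟩ := hQ.exists_ne_zero hδ
  refine ⟨φ, fun T g hg Z ζ => ?_, fun T ψ => ?_⟩
  · by_contra h0
    obtain ⟨c, hc⟩ := h₂ _ h0
    exact hφ (by rw [← hc, ← ExtBifunctor.push_pull, hg])
  · have := hfin T X
    obtain ⟨g, hg⟩ := hQ.exists_repr_right (pushPairing φ T) (fun ζ hζ => by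
      by_contra h0
      obtain ⟨g, hg⟩ := h₁ ζ h0
      exact hφ (hg ▸ hζ g)) ψ
    exact ⟨g, fun ζ => by rw [← hg]; rfl⟩

section Determined

variable {X A : C} {φ : 𝓒.E.Ext X A →ₗ[k] Q}

omit [IsArtinianRing k] in
-- The pull-backs of ξ to X form the kernel of pushing along `M.dFirst`. So φ factors through that
-- push, extends by injectivity of Q, and is represented by some g. Then M.dFirst ≫ g acts as the
-- identity on extensions by A, yet it kills ξ.
theorem IsDualizing.eq_zero_of_pull (hφ : IsDualizing φ) (hn : 1 ≤ n)
    (hQ : IsInjectiveCogenerator k Q) {Y : C} (ξ : 𝓒.E.Ext Y A)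
    (h : ∀ c : X ⟶ Y, φ (𝓒.E.pull c ξ) = 0) : ξ = 0 := by
  obtain ⟨M, hM⟩ := 𝓒.exists_distinguished ξ
  set p : 𝓒.E.Ext X A →ₗ[k] 𝓒.E.Ext X (M.X 1) := 𝓒.E.push M.dFirst
  have hker : LinearMap.ker p ≤ LinearMap.ker φ := fun θ hθ => by
    obtain ⟨c, rfl⟩ := exists_pull_eq hn hM θ hθ
    exact h c
  obtain ⟨ψ, hψ⟩ := hQ.baer.extension_property (LinearMap.range p).subtype
    (Submodule.subtype_injective _)
    ((LinearMap.ker p).liftQ φ hker ∘ₗ p.quotKerEquivRange.symm.toLinearMap)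
  have hψ' : ∀ θ, ψ (p θ) = φ θ := fun θ => by
    have h1 := LinearMap.congr_fun hψ ⟨p θ, LinearMap.mem_range_self p θ⟩
    have h2 : p.quotKerEquivRange.symm ⟨p θ, LinearMap.mem_range_self p θ⟩ =
        Submodule.Quotient.mk θ := by
      rw [LinearEquiv.symm_apply_eq]; rfl
    simpa [h2] using h1
  obtain ⟨g, hg⟩ := hφ.exists_eq ψ
  have h3 : 𝓒.InjTrivial (M.dFirst ≫ g - 𝟙 A) := hφ.injTrivial _ fun ζ => by
    rw [ExtBifunctor.push_sub, map_sub, ExtBifunctor.push_comp, ← hg, hψ', ExtBifunctor.push_id,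
      sub_self]
  have h4 := h3 Y ξ
  rw [ExtBifunctor.push_sub, ExtBifunctor.push_comp, (𝓒.exact.R1 ξ M hM).push_dFirst, map_zero,
    ExtBifunctor.push_id, zero_sub, neg_eq_zero] at h4
  exact h4

omit [IsArtinianRing k] in
-- A functional detecting c^* ζ has the form φ ∘ g_*, so the extension g_* ζ by A detects `c` as
-- well.
theorem IsDualizing.projTrivial (hφ : IsDualizing φ) (hQ : IsInjectiveCogenerator k Q) {Y : C}
    (c : X ⟶ Y) (h : ∀ ξ : 𝓒.E.Ext Y A, φ (𝓒.E.pull c ξ) = 0) : 𝓒.ProjTrivial c :=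
  fun Z ζ => by
    by_contra h0
    obtain ⟨ψ, hψ⟩ := hQ.exists_ne_zero h0
    obtain ⟨g, hg⟩ := hφ.exists_eq ψ
    exact hψ (by rw [hg, ExtBifunctor.push_pull, h])

/-- Double annihilator property of the pairing defined by a dualizing functional. -/
theorem IsDualizing.exists_separating (hφ : IsDualizing φ)
    (hQ : IsMinimalInjectiveCogenerator k Q) (hfin : 𝓒.ExtFinite) {Y : C}
    (H : Submodule k (X ⟶ Y)) (hH : ∀ f : X ⟶ Y, 𝓒.ProjTrivial f → f ∈ H) {f : X ⟶ Y}
    (hf : f ∉ H) :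
    ∃ ξ : 𝓒.E.Ext Y A, (∀ h ∈ H, φ (𝓒.E.pull h ξ) = 0) ∧ φ (𝓒.E.pull f ξ) ≠ 0 := by
  have := hfin A Y
  obtain ⟨ψ, hψ⟩ := hQ.exists_ne_zero (m := H.mkQ f)
    (by rwa [Submodule.mkQ_apply, Ne, Submodule.Quotient.mk_eq_zero])
  let β := pullPairing φ Y
  -- The left kernel consists of projectively trivial morphisms, hence lies in H. A functional on
  -- C(X, Y) / H thus descends to the quotient by the left kernel, where it is given by an
  -- extension; only 𝔼(Y, A) has to be finitely generated.
  have hker : LinearMap.ker β ≤ LinearMap.ker (ψ ∘ₗ H.mkQ) := fun c hc => by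
    have : c ∈ H := hH c (hφ.projTrivial hQ.toIsInjectiveCogenerator c fun ξ =>
      LinearMap.congr_fun hc ξ)
    rw [LinearMap.mem_ker, LinearMap.comp_apply, Submodule.mkQ_apply,
      (Submodule.Quotient.mk_eq_zero H).2 this, map_zero]
  obtain ⟨ξ, hξ⟩ := hQ.exists_repr_left ((LinearMap.ker β).liftQ β le_rfl)
    (LinearMap.ker_eq_bot.1 (Submodule.ker_liftQ_eq_bot _ _ _ le_rfl))
    ((LinearMap.ker β).liftQ (ψ ∘ₗ H.mkQ) hker)
  have hξ' : ∀ c, ψ (H.mkQ c) = φ (𝓒.E.pull c ξ) := fun c =>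
    hξ (Submodule.Quotient.mk c)
  refine ⟨ξ, fun h hh => ?_, (hξ' f).symm ▸ hψ⟩
  rw [← hξ', Submodule.mkQ_apply, (Submodule.Quotient.mk_eq_zero H).2 hh, map_zero]

/-- If `D 𝔼(X, -)` is representable, every `End X`-submodule of `C(X, Y)` containing the
projectively trivial morphisms is the image of a right `X`-determined deflation. -/
theorem IsDualizing.exists_rightDetermined (hφ : IsDualizing φ) (hn : 1 ≤ n)
    (hQ : IsMinimalInjectiveCogenerator k Q) (hfin : 𝓒.ExtFinite) {Y : C}
    (H : Submodule (End X)ᵐᵒᵖ (X ⟶ Y)) (hH : ∀ f : X ⟶ Y, 𝓒.ProjTrivial f → f ∈ H) :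
    ∃ (B : C) (η : 𝓒.E.Ext Y B) (M : NComplex n B Y), 𝓒.Distinguished M η ∧
      RightDetermined X M.dLast ∧
      ∀ f : X ⟶ Y, f ∈ H ↔ ∃ g : X ⟶ M.X n, g ≫ M.dLast = f := by
  have hcomp : ∀ f ∈ H, ∀ c : X ⟶ X, c ≫ f ∈ H := fun f hf c =>
    H.smul_mem (MulOpposite.op (show End X from c)) hf
  let Hk : Submodule k (X ⟶ Y) :=
    { carrier := H
      add_mem' := H.add_mem
      zero_mem' := H.zero_mem
      smul_mem' := fun r f hf => by
        have : r • f = (r • 𝟙 X) ≫ f := by simp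
        rw [this]
        exact hcomp f hf _ }
  have := hfin A Y
  -- The annihilator of H. Its generators are assembled into one extension η by a power of A, so
  -- that g^* η = 0 exactly when g^* kills all of P.
  let P : Submodule k (𝓒.E.Ext Y A) :=
    ⨅ h : Hk, LinearMap.ker (pullPairing φ Y h.1)
  have hP : ∀ ξ, ξ ∈ P ↔ ∀ h ∈ H, φ (𝓒.E.pull h ξ) = 0 := fun ξ => by
    rw [Submodule.mem_iInf]
    exact ⟨fun h c hc => h ⟨c, hc⟩, fun h c => h c.1 c.2⟩
  obtain ⟨m, ξ, hξ⟩ := Submodule.fg_iff_exists_fin_generating_family.1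
    (IsNoetherian.noetherian P)
  let η : 𝓒.E.Ext Y (⨁ fun _ : Fin m => A) :=
    ∑ i, 𝓒.E.push (biproduct.ι (fun _ : Fin m => A) i) (ξ i)
  have hπ : ∀ i, 𝓒.E.push (biproduct.π (fun _ : Fin m => A) i) η = ξ i := fun i => by
    rw [map_sum, Finset.sum_eq_single i]
    · rw [← ExtBifunctor.push_comp, biproduct.ι_π_self, ExtBifunctor.push_id]
    · intro b _ hb
      rw [← ExtBifunctor.push_comp, biproduct.ι_π_ne _ hb, ExtBifunctor.push_zero]
    · simp
  have hpull : ∀ ⦃T : C⦄ (g : T ⟶ Y), 𝓒.E.pull g η = 0 ↔ ∀ i, 𝓒.E.pull g (ξ i) = 0 :=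
    fun T g => by
      refine ⟨fun h i => by rw [← hπ i, ← ExtBifunctor.push_pull, h, map_zero], fun h => ?_⟩
      rw [map_sum]
      exact Finset.sum_eq_zero fun i _ => by rw [← ExtBifunctor.push_pull, h i, map_zero]
  obtain ⟨M, hM⟩ := 𝓒.exists_distinguished η
  refine ⟨_, η, M, hM, fun L g hg => ?_, fun f => ?_⟩
  · rw [factorsThrough_dLast_iff hM, hpull]
    refine fun i => hφ.eq_zero_of_pull hn hQ.toIsInjectiveCogenerator _ fun c => ?_
    have := (hpull _).1 ((factorsThrough_dLast_iff hM _).1 (hg c)) i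
    rw [← ExtBifunctor.pull_comp, this, map_zero]
  · change f ∈ H ↔ FactorsThrough f M.dLast
    rw [factorsThrough_dLast_iff hM, hpull]
    have hmem : ∀ i, ξ i ∈ P := fun i => hξ ▸ Submodule.subset_span ⟨i, rfl⟩
    refine ⟨fun hf i => hφ.eq_zero_of_pull hn hQ.toIsInjectiveCogenerator _ fun c => ?_,
      fun h => ?_⟩
    -- Here H being an End X-submodule is essential: c ≫ f stays in H, so it pairs to zero with the
    -- generators of P.
    · rw [← ExtBifunctor.pull_comp]
      exact (hP _).1 (hmem i) _ (hcomp f hf c)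
    · by_contra hf
      obtain ⟨ζ, hζ, hζf⟩ := hφ.exists_separating hQ hfin Hk hH (f := f) hf
      have hle : P ≤ LinearMap.ker (𝓒.E.pull f) := by
        rw [← hξ, Submodule.span_le]
        rintro _ ⟨i, rfl⟩
        exact h i
      exact hζf (by rw [hle ((hP ζ).2 hζ), map_zero])

end Determined

omit [IsArtinianRing k] in
/-- Dualizing functionals on the summands assemble to one on a direct sum. -/
theorem exists_isDualizing_biproduct {X : C} {m : ℕ} {Y : Fin m → C} (e : X ≅ ⨁ Y)
    (h : ∀ i, ∃ (A : C) (φ : 𝓒.E.Ext (Y i) A →ₗ[k] Q), IsDualizing φ) :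
    ∃ (A : C) (φ : 𝓒.E.Ext X A →ₗ[k] Q), IsDualizing φ := by
  choose A φ hφ using h
  let ι : ∀ i, Y i ⟶ X := fun i => biproduct.ι Y i ≫ e.inv
  let π : ∀ i, X ⟶ Y i := fun i => e.hom ≫ biproduct.π Y i
  have hπι : ∑ i, π i ≫ ι i = 𝟙 X := biproduct_iso_total e
  have hιπ : ∀ i, ι i ≫ π i = 𝟙 (Y i) := fun i => by simp [ι, π]
  have hne : ∀ i j, i ≠ j → ι i ≫ π j = 0 := fun i j hij => by
    simp [ι, π, biproduct.ι_π_ne _ hij]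
  -- The trace of the matrix of components of an extension, each diagonal entry being evaluated by
  -- its own φ.
  let Φ : 𝓒.E.Ext X (⨁ A) →ₗ[k] Q :=
    ∑ i, φ i ∘ₗ 𝓒.E.push (biproduct.π A i) ∘ₗ 𝓒.E.pull (ι i)
  have hΦ : ∀ ⦃T : C⦄ (g : T ⟶ ⨁ A) (ζ : 𝓒.E.Ext X T),
      Φ (𝓒.E.push g ζ) = ∑ i, φ i (𝓒.E.push (g ≫ biproduct.π A i) (𝓒.E.pull (ι i) ζ)) :=
    fun T g ζ => by
      simp only [Φ, LinearMap.sum_apply, LinearMap.comp_apply, ← ExtBifunctor.push_pull,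
        ← ExtBifunctor.push_comp]
  refine ⟨⨁ A, Φ, fun T g hg => ?_, fun T ψ => ?_⟩
  · have hg' : ∀ i, 𝓒.InjTrivial (g ≫ biproduct.π A i) := fun i =>
      (hφ i).injTrivial _ fun ζ => by
        have := hg (𝓒.E.pull (π i) ζ)
        rw [hΦ, Finset.sum_eq_single i] at this
        · rwa [← ExtBifunctor.pull_comp, hιπ, ExtBifunctor.pull_id] at this
        · intro j _ hj
          rw [← ExtBifunctor.pull_comp, hne j i hj, ExtBifunctor.pull_zero, map_zero, map_zero]
        · simp
    intro Z ζ
    have hsum : g = ∑ i, (g ≫ biproduct.π A i) ≫ biproduct.ι A i := by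
      simp_rw [Category.assoc]
      rw [← Preadditive.comp_sum, biproduct.total, Category.comp_id]
    rw [hsum, ExtBifunctor.push_sum]
    exact Finset.sum_eq_zero fun i _ => by rw [ExtBifunctor.push_comp, hg' i, map_zero]
  · choose g hg using fun i => (hφ i).exists_eq (ψ ∘ₗ 𝓒.E.pull (π i))
    refine ⟨biproduct.lift g, fun ζ => ?_⟩
    simp only [hΦ, biproduct.lift_π, ← hg, LinearMap.comp_apply]
    rw [← map_sum]
    congr 1
    simp only [← ExtBifunctor.pull_comp]
    rw [← ExtBifunctor.pull_sum, hπι, ExtBifunctor.pull_id]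

omit [IsArtinianRing k] in
-- The functor is zero, so it is represented by a zero object.
theorem exists_isDualizing_of_isProjective {P : C} (hP : 𝓒.IsProjective P) :
    ∃ (A : C) (φ : 𝓒.E.Ext P A →ₗ[k] Q), IsDualizing φ := by
  have hZ : IsZero (⨁ (Fin.elim0 : Fin 0 → C)) := (IsZero.iff_id_eq_zero _).2 (by
    rw [← biproduct.total]; simp)
  refine ⟨⨁ (Fin.elim0 : Fin 0 → C), 0, fun T g _ Z ζ => ?_, fun T ψ => ⟨0, fun ζ => ?_⟩⟩
  · rw [hZ.eq_of_tgt g 0, ExtBifunctor.push_zero]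
  · rw [ext_eq_zero_of_isProjective hP ζ, map_zero, map_zero, map_zero]

end NExangulated

end

end NExang

namespace NExang

section

variable {k : Type uk} [CommRing k] {C : Type u} [Category.{v} C] [Preadditive C] [Linear k C]
  [HasFiniteBiproducts C] {n : ℕ} {𝓒 : NExangulated.{w} k C n}

/-! ### Auslander–Reiten extensions and the equivalent conditions -/

namespace NExangulated

/-- `X` is the end term of a nonzero extension to which every nonzero extension of `X` can be
pushed out. -/
def HasPushEssential (𝓒 : NExangulated.{w} k C n) (X : C) : Prop :=
  ∃ (A : C) (δ : 𝓒.E.Ext X A), δ ≠ 0 ∧ 𝓒.E.PushEssential δ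

/-- Push-outs of a push-essential extension are push-essential, so A may be replaced by a local
summand. Reversibility then makes every non-split monomorphism kill the extension, which gives
pull-essentiality by exactness. -/
theorem HasPushEssential.exists_local (hKS : KrullSchmidt C) (hn : 1 ≤ n) {X : C}
    (hX : 𝓒.HasPushEssential X) :
    ∃ (A : C) (_ : IsLocalRing (End A)) (δ : 𝓒.E.Ext X A), δ ≠ 0 ∧ 𝓒.E.PushEssential δ ∧
      𝓒.E.PullEssential δ := by
  obtain ⟨A, δ, hδ, h⟩ := hX
  obtain ⟨A', hA', p, -, -, hp⟩ := ExtBifunctor.exists_push_ne_zero hKS hδ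
  have h' := h.push p
  exact ⟨A', hA', _, hp, h', pullEssential_of_push_eq_zero hn fun L a ha =>
    h'.pushReversible.push_eq_zero hA' hp ha⟩

theorem HasPushEssential.of_pull_eq_zero (hn : 1 ≤ n) {X A : C} {δ : 𝓒.E.Ext X A} (hδ : δ ≠ 0)
    (h : ∀ ⦃L : C⦄ (c : L ⟶ X), ¬ IsSplitEpi c → 𝓒.E.pull c δ = 0) : 𝓒.HasPushEssential X :=
  ⟨A, δ, hδ, pushEssential_of_pull_eq_zero hn h⟩

section Local

variable {X : C}

/-- An extension of objects with local endomorphism rings that is essential on both sides is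
realized by an Auslander-Reiten `n`-exangle. -/
theorem HasPushEssential.exists_isAuslanderReiten (hKS : KrullSchmidt C) (hn : 1 ≤ n)
    (hX : IsLocalRing (End X)) (h : 𝓒.HasPushEssential X) :
    ∃ (A : C) (δ : 𝓒.E.Ext X A) (M : NComplex n A X), 𝓒.IsAuslanderReiten M δ := by
  obtain ⟨A, hA, δ, hδ, h₁, h₂⟩ := h.exists_local hKS hn
  obtain ⟨M, hM, hrad⟩ := exists_distinguished_inRadical hKS δ
  refine ⟨A, δ, M, hM, ⟨mt (isSplitMono_dFirst_iff hM).1 hδ, fun L g hg => ?_⟩,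
    ⟨mt (isSplitEpi_dLast_iff hM).1 hδ, fun L g hg => ?_⟩, hrad⟩
  · exact (cofactorsThrough_dFirst_iff hM g).2 (h₁.pushReversible.push_eq_zero hA hδ hg)
  · exact (factorsThrough_dLast_iff hM g).2 (h₂.pull_eq_zero hX hδ hg)

theorem IsAuslanderReiten.hasPushEssential (hn : 1 ≤ n) {A : C} {δ : 𝓒.E.Ext X A}
    {M : NComplex n A X} (h : 𝓒.IsAuslanderReiten M δ) : 𝓒.HasPushEssential X :=
  .of_pull_eq_zero hn (mt (isSplitEpi_dLast_iff h.distinguished).2 h.right.1) fun _ c hc =>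
    (factorsThrough_dLast_iff h.distinguished c).1 (h.right.2 c hc)

/-- The last morphism of an Auslander-Reiten `n`-exangle is a deflation, right determined by its
target. -/
theorem IsAuslanderReiten.rightDetermined {A : C} {δ : 𝓒.E.Ext X A}
    {M : NComplex n A X} (h : 𝓒.IsAuslanderReiten M δ) : RightDetermined X M.dLast :=
  fun L g hg => by
    by_cases hs : IsSplitEpi g
    · refine (h.right.1 ?_).elim
      obtain ⟨s, hs'⟩ := hg (section_ g)
      exact IsSplitEpi.mk' ⟨s, by rw [hs', IsSplitEpi.id]⟩
    · exact h.right.2 g hs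

/-- The first morphism of an Auslander-Reiten `n`-exangle is left determined by its source. -/
theorem IsAuslanderReiten.leftDetermined {A : C} {δ : 𝓒.E.Ext X A}
    {M : NComplex n A X} (h : 𝓒.IsAuslanderReiten M δ) : LeftDetermined A M.dFirst :=
  fun L g hg => by
    by_cases hs : IsSplitMono g
    · refine (h.left.1 ?_).elim
      obtain ⟨s, hs'⟩ := hg (retraction g)
      exact IsSplitMono.mk' ⟨s, by rw [hs', IsSplitMono.id]⟩
    · exact h.left.2 g hs

theorem Distinguished.deflation {A : C} {δ : 𝓒.E.Ext X A} {M : NComplex n A X}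
    (h : 𝓒.Distinguished M δ) : 𝓒.Deflation M.dLast :=
  ⟨A, δ, M, Iso.refl _, h, by simp⟩

theorem Distinguished.inflation {A : C} {δ : 𝓒.E.Ext X A} {M : NComplex n A X}
    (h : 𝓒.Distinguished M δ) : 𝓒.Inflation M.dFirst :=
  ⟨X, δ, M, Iso.refl _, h, by simp⟩

theorem IsAuslanderReiten.isIntrinsicWeakCokernel (hn : 1 ≤ n) (hX : IsLocalRing (End X)) {A : C}
    {δ : 𝓒.E.Ext X A} {M : NComplex n A X} (h : 𝓒.IsAuslanderReiten M δ) :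
    𝓒.IsIntrinsicWeakCokernel M.dFirst X := by
  have hrad : ∀ i, 1 ≤ i → i ≤ n → InRadical (M.d i) := fun i h1 h2 => by
    rcases h2.lt_or_eq with h2 | rfl
    · exact h.radical i h1 h2
    · have : M.d i = M.dLast ≫ M.right.inv := by simp [NComplex.dLast]
      rw [this]
      exact (inRadical_of_not_isSplitEpi h.right.1).comp_right _
  refine ⟨δ, M, h.distinguished, fun φ hφ => ?_, ⟨⟨𝟙 _, Category.comp_id _⟩,
    ⟨𝟙 _, Category.comp_id _⟩⟩, hrad⟩
  -- Left minimality comes from the next differential: 1 - φ factors through the radical map `M.d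
  -- 1`, so φ is invertible. For n = 1 this differential is the last one, which is radical because
  -- it is right almost split with local target.
  have h0 : M.d 0 ≫ (𝟙 _ - φ) = 0 := by
    have hd : M.d 0 = M.left.hom ≫ M.dFirst := by simp [NComplex.dFirst]
    rw [hd, Category.assoc, Preadditive.comp_sub, hφ, Category.comp_id, sub_self, comp_zero]
  obtain ⟨ψ, hψ⟩ := (𝓒.exact.R1 δ M h.distinguished).exact_left 0 hn _ h0
  have h1 := hrad 1 le_rfl hn ψ
  have h2 : M.d 1 ≫ ψ = 𝟙 _ - φ := hψ
  rwa [h2, sub_sub_cancel] at h1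

/-- If `f` almost factors through the deflation `α`, there is an Auslander-Reiten extension of the
source of `f`. -/
theorem hasPushEssential_of_almostFactorsThrough (hn : 1 ≤ n) (hX : IsLocalRing (End X))
    {Z Y : C} {α : Z ⟶ Y} (hα : 𝓒.Deflation α) {f : X ⟶ Y} (hf : AlmostFactorsThrough f α) :
    𝓒.HasPushEssential X := by
  obtain ⟨A, δ, M, e, hM, rfl⟩ := hα
  have key : ∀ {T : C} (g : T ⟶ Y), FactorsThrough g (e.inv ≫ M.dLast) ↔ 𝓒.E.pull g δ = 0 :=
    fun g => by
      rw [← factorsThrough_dLast_iff hM]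
      exact ⟨fun ⟨s, hs⟩ => ⟨s ≫ e.inv, by simpa using hs⟩,
        fun ⟨s, hs⟩ => ⟨s ≫ e.hom, by simpa using hs⟩⟩
  refine .of_pull_eq_zero (δ := 𝓒.E.pull f δ) hn (mt (key f).2 hf.1) fun L c hc => ?_
  rw [← ExtBifunctor.pull_comp]
  exact (key _).1 (hf.2 c (inRadical_of_not_isSplitEpi hc))

variable [IsArtinianRing k]

/-- A right `X`-determined deflation that is not a split epimorphism yields an Auslander-Reiten
extension of `X`. -/
theorem hasPushEssential_of_rightDetermined (hn : 1 ≤ n) (hfin : 𝓒.ExtFinite)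
    (hX : IsLocalRing (End X)) {Z Y : C} {α : Z ⟶ Y} (hα : 𝓒.Deflation α)
    (hs : ¬ IsSplitEpi α) (hd : RightDetermined X α) : 𝓒.HasPushEssential X := by
  obtain ⟨A, δ, M, e, hM, rfl⟩ := hα
  have key : ∀ {T : C} (g : T ⟶ Y), FactorsThrough g (e.inv ≫ M.dLast) ↔ 𝓒.E.pull g δ = 0 :=
    fun g => by
      rw [← factorsThrough_dLast_iff hM]
      exact ⟨fun ⟨s, hs⟩ => ⟨s ≫ e.inv, by simpa using hs⟩,
        fun ⟨s, hs⟩ => ⟨s ≫ e.hom, by simpa using hs⟩⟩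
  have hdet : ∀ {T : C} (g : T ⟶ Y), 𝓒.E.pull g δ ≠ 0 →
      ∃ h : X ⟶ T, 𝓒.E.pull h (𝓒.E.pull g δ) ≠ 0 := fun g hg => by
    by_contra hcon
    push Not at hcon
    refine hg ((key g).1 (hd g fun h => (key _).2 ?_))
    rw [ExtBifunctor.pull_comp, hcon]
  have hδ : 𝓒.E.pull (𝟙 Y) δ ≠ 0 := fun h0 => hs <| by
    obtain ⟨s, hs'⟩ := (key _).2 h0
    exact IsSplitEpi.mk' ⟨s, hs'⟩
  have := hfin A X
  obtain ⟨h₀, hh₀⟩ := hdet (𝟙 Y) hδ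
  -- Minimal choice among the pull-backs of δ to X. If c does not kill it, determination returns to
  -- X by some h with nonzero pull-back, and minimality recovers the original extension; locality
  -- then splits c.
  obtain ⟨-, ⟨g, rfl⟩, hne, hmin⟩ := ExtBifunctor.exists_pull_minimal
    (Set.range fun g : X ⟶ Y => 𝓒.E.pull g δ)
    (by
      rintro _ ⟨g, rfl⟩ c
      exact ⟨c ≫ g, ExtBifunctor.pull_comp _ _ _ _⟩)
    ⟨_, ⟨h₀, by rw [ExtBifunctor.pull_id]⟩, hh₀⟩
  refine .of_pull_eq_zero hn hne fun L c hc => ?_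
  by_contra h0
  simp only [← ExtBifunctor.pull_comp] at h0
  obtain ⟨h, hh⟩ := hdet _ h0
  simp only [ExtBifunctor.pull_comp] at hh
  rw [← ExtBifunctor.pull_comp] at hh
  obtain ⟨b, hb⟩ := hmin _ hh
  rw [ExtBifunctor.pull_comp, ← ExtBifunctor.pull_comp] at hb
  exact hc (𝓒.E.isSplitEpi_of_pull_pull hX hne c _ hb)

/-- If `X` is the intrinsic weak cokernel of a left determined inflation, there is an
Auslander-Reiten extension of `X`. -/
theorem IsIntrinsicWeakCokernel.hasPushEssential (hn : 1 ≤ n) (hKS : KrullSchmidt C)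
    (hfin : 𝓒.ExtFinite) (hX : IsLocalRing (End X)) {A A₁ : C} {α : A ⟶ A₁}
    (hα : 𝓒.IsIntrinsicWeakCokernel α X) {K : C} (hK : LeftDetermined K α) :
    𝓒.HasPushEssential X := by
  obtain ⟨δ, M, hM, -, ⟨⟨s, hs⟩, ⟨t, ht⟩⟩, hrad⟩ := hα
  have key : ∀ {T : C} (g : A ⟶ T), CofactorsThrough g α ↔ 𝓒.E.push g δ = 0 := fun g => by
    rw [← cofactorsThrough_dFirst_iff hM]
    exact ⟨fun ⟨a, ha⟩ => ⟨s ≫ a, by rw [← ha, ← hs, Category.assoc]⟩,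
      fun ⟨a, ha⟩ => ⟨t ≫ a, by rw [← ha, ← ht, Category.assoc]⟩⟩
  have hdet : ∀ {T : C} (g : A ⟶ T), 𝓒.E.push g δ ≠ 0 →
      ∃ h : T ⟶ K, 𝓒.E.push h (𝓒.E.push g δ) ≠ 0 := fun g hg => by
    by_contra hcon
    push Not at hcon
    refine hg ((key g).1 (hK g fun h => (key _).2 ?_))
    rw [ExtBifunctor.push_comp, hcon]
  -- The last map is radical with nonzero target, so it does not split.
  have hδ : 𝓒.E.push (𝟙 A) δ ≠ 0 := fun h0 => by
    rw [ExtBifunctor.push_id] at h0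
    refine InRadical.not_isSplitEpi ?_ not_isZero_of_isLocalRing ((isSplitEpi_dLast_iff hM).2 h0)
    exact (hrad n hn le_rfl).comp_right _
  have := hfin K X
  obtain ⟨h₀, hh₀⟩ := hdet (𝟙 A) hδ
  obtain ⟨-, ⟨g, rfl⟩, hne, hmin⟩ := ExtBifunctor.exists_push_minimal
    (Set.range fun g : A ⟶ K => 𝓒.E.push g δ)
    (by
      rintro _ ⟨g, rfl⟩ c
      exact ⟨g ≫ c, ExtBifunctor.push_comp _ _ _ _⟩)
    ⟨_, ⟨h₀, by rw [ExtBifunctor.push_id]⟩, hh₀⟩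
  have hrev : 𝓒.E.PushReversible (𝓒.E.push g δ) := fun T a ha => by
    rw [← ExtBifunctor.push_comp] at ha
    obtain ⟨h, hh⟩ := hdet _ ha
    rw [ExtBifunctor.push_comp, ← ExtBifunctor.push_comp _ a] at hh
    obtain ⟨b, hb⟩ := hmin _ hh
    rw [ExtBifunctor.push_comp _ a, ← ExtBifunctor.push_comp _ h] at hb
    exact ⟨_, hb⟩
  -- `K` need not be indecomposable, so the reversible extension is moved to a local summand of it
  -- before passing from push-outs to pull-backs.
  obtain ⟨K', hK', p, hp, hrev'⟩ := hrev.exists_local hKS hne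
  exact .of_pull_eq_zero hn hp fun L c hc =>
    (pullEssential_of_push_eq_zero hn fun L a ha =>
      hrev'.push_eq_zero hK' hp ha).pull_eq_zero hX hp hc

end Local

/-- If all `End X`-submodules of `C(X, Y)` containing the projectively trivial morphisms are images
of right `X`-determined deflations, the nonprojective summands of `X` with local endomorphism ring
are end terms of Auslander-Reiten extensions. -/
theorem hasPushEssential_of_forall_submodule (hn : 1 ≤ n) {X X' : C}
    (h : ∀ (Y : C) (H : Submodule (End X)ᵐᵒᵖ (X ⟶ Y)), (∀ f : X ⟶ Y, 𝓒.ProjTrivial f → f ∈ H) →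
        ∃ (A : C) (η : 𝓒.E.Ext Y A) (M : NComplex n A Y), 𝓒.Distinguished M η ∧
          RightDetermined X M.dLast ∧
          ∀ f : X ⟶ Y, f ∈ H ↔ ∃ g : X ⟶ M.X n, g ≫ M.dLast = f)
    (hX' : IsLocalRing (End X')) (hP : ¬ 𝓒.IsProjective X') (ι : X' ⟶ X) (π : X ⟶ X')
    (hιπ : ι ≫ π = 𝟙 X') : 𝓒.HasPushEssential X' := by
  -- Radical morphisms form a submodule containing the projectively trivial ones: a projectively
  -- trivial split epimorphism onto `X'` would annihilate all extensions of `X'` and make it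
  -- projective.
  let H : Submodule (End X)ᵐᵒᵖ (X ⟶ X') :=
    { carrier := {f | InRadical f}
      add_mem' := fun ha hb => InRadical.add ha hb
      zero_mem' := inRadical_zero _ _
      smul_mem' := fun c f hf => InRadical.comp_left hf (show X ⟶ X from c.unop) }
  obtain ⟨A, η, M, hM, hdet, hH⟩ := h X' H fun f hf => inRadical_of_not_isSplitEpi fun hs =>
    hP (isProjective_of_ext_eq_zero fun Z ζ => 𝓒.E.eq_zero_of_pull hs (hf Z ζ))
  -- Were η zero, every morphism to `X'` would factor, and the split epimorphism π would be radical.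
  have hne : η ≠ 0 := fun h0 => by
    have := (isSplitEpi_dLast_iff hM).2 h0
    have hπ : InRadical π := (hH π).2 ⟨π ≫ section_ M.dLast, by simp⟩
    exact hπ.not_isSplitEpi not_isZero_of_isLocalRing (IsSplitEpi.mk' ⟨ι, hιπ⟩)
  -- If c is not a split epimorphism, every a ≫ c is radical and factors through the deflation;
  -- determination makes c itself factor.
  exact .of_pull_eq_zero hn hne fun L c hc => (factorsThrough_dLast_iff hM c).1 <|
    hdet c fun a => (hH _).1 ((inRadical_of_not_isSplitEpi hc).comp_left a)

/-- Representability of `D 𝔼(X, -)` is equivalent to the realizability of submodules of `C(X, Y)`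
by right `X`-determined deflations. -/
theorem inCr_iff_forall_submodule [IsArtinianRing k] {Q : Type uk} [AddCommGroup Q] [Module k Q]
    (hQ : IsMinimalInjectiveCogenerator k Q) (hn : 1 ≤ n) (hfin : 𝓒.ExtFinite)
    (hKS : KrullSchmidt C) (X : C) :
    𝓒.InCr Q X ↔
      ∀ (Y : C) (H : Submodule (End X)ᵐᵒᵖ (X ⟶ Y)), (∀ f : X ⟶ Y, 𝓒.ProjTrivial f → f ∈ H) →
        ∃ (A : C) (η : 𝓒.E.Ext Y A) (M : NComplex n A Y), 𝓒.Distinguished M η ∧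
          RightDetermined X M.dLast ∧
          ∀ f : X ⟶ Y, f ∈ H ↔ ∃ g : X ⟶ M.X n, g ≫ M.dLast = f := by
  rw [inCr_iff]
  constructor
  · rintro ⟨A, φ, hφ⟩ Y H hH
    exact hφ.exists_rightDetermined hn hQ hfin H hH
  · intro h
    obtain ⟨m, Y, hY, ⟨e⟩⟩ := hKS X
    refine exists_isDualizing_biproduct e fun i => ?_
    by_cases hP : 𝓒.IsProjective (Y i)
    · exact exists_isDualizing_of_isProjective hP
    · obtain ⟨A, -, δ, hδ, h₁, h₂⟩ := (hasPushEssential_of_forall_submodule hn h (hY i) hP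
        (biproduct.ι Y i ≫ e.inv) (e.hom ≫ biproduct.π Y i) (by simp)).exists_local hKS hn
      exact ⟨A, exists_isDualizing_of_essential hQ hfin hδ h₁ h₂⟩

end NExangulated

end

end NExang

theorem theorem4p17
    {k : Type uk} [CommRing k] [IsArtinianRing k]
    {Q : Type uk} [AddCommGroup Q] [Module k Q]
    (hQ : NExang.IsMinimalInjectiveCogenerator k Q)
    {𝒞 : Type u} [Category.{v} 𝒞] [Preadditive 𝒞] [Linear k 𝒞] [HasFiniteBiproducts 𝒞]
    {n : ℕ} (hn : 1 ≤ n) (𝓒 : NExang.NExangulated.{w} k 𝒞 n)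
    (hfin : 𝓒.ExtFinite) (hKS : NExang.KrullSchmidt 𝒞) (hWIC : 𝓒.WIC)
    (C : 𝒞) :
    (𝓒.InCr Q C ↔
      ∀ (Y : 𝒞) (H : Submodule (End C)ᵐᵒᵖ (C ⟶ Y)), (∀ f : C ⟶ Y, 𝓒.ProjTrivial f → f ∈ H) →
        ∃ (A : 𝒞) (η : 𝓒.E.Ext Y A) (X : NExang.NComplex n A Y), 𝓒.Distinguished X η ∧
          NExang.RightDetermined C X.dLast ∧
          ∀ f : C ⟶ Y, f ∈ H ↔ ∃ g : C ⟶ X.X n, g ≫ X.dLast = f) ∧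
    (¬ 𝓒.IsProjective C → Indecomposable C →
      List.TFAE [
        -- (1)
        𝓒.InCr Q C,
        -- (2)
        ∀ (Y : 𝒞) (H : Submodule (End C)ᵐᵒᵖ (C ⟶ Y)), (∀ f : C ⟶ Y, 𝓒.ProjTrivial f → f ∈ H) →
          ∃ (A : 𝒞) (η : 𝓒.E.Ext Y A) (X : NExang.NComplex n A Y), 𝓒.Distinguished X η ∧
            NExang.RightDetermined C X.dLast ∧
            ∀ f : C ⟶ Y, f ∈ H ↔ ∃ g : C ⟶ X.X n, g ≫ X.dLast = f,
        -- (3)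
        ∃ (X₀ X₁ : 𝒞) (α : X₀ ⟶ X₁), 𝓒.Inflation α ∧ 𝓒.IsIntrinsicWeakCokernel α C ∧
          ∃ K : 𝒞, NExang.LeftDetermined K α,
        -- (4)
        ∃ (A : 𝒞) (δ : 𝓒.E.Ext C A) (X : NExang.NComplex n A C), 𝓒.IsAuslanderReiten X δ,
        -- (5)
        ∃ (X Y : 𝒞) (α : X ⟶ Y), 𝓒.Deflation α ∧ ¬ IsSplitEpi α ∧ NExang.RightDetermined C α,
        -- (6)
        ∃ (X Y : 𝒞) (α : X ⟶ Y) (f : C ⟶ Y), 𝓒.Deflation α ∧ NExang.AlmostFactorsThrough f α]) := by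
  have h12 := NExang.NExangulated.inCr_iff_forall_submodule (𝓒 := 𝓒) hQ hn hfin hKS C
  refine ⟨h12, fun hP hC => ?_⟩
  have hloc := hKS.isLocalRing_of_indecomposable hC
  tfae_have 1 ↔ 2 := h12
  tfae_have 2 → 4 := fun h =>
    (NExang.NExangulated.hasPushEssential_of_forall_submodule hn h hloc hP (𝟙 C) (𝟙 C)
      (Category.comp_id _)).exists_isAuslanderReiten hKS hn hloc
  tfae_have 4 → 1 := by
    rintro ⟨A, δ, X, h⟩
    obtain ⟨A', -, δ', hδ', h₁, h₂⟩ := (h.hasPushEssential hn).exists_local hKS hn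
    exact (NExang.NExangulated.inCr_iff C).2
      ⟨A', NExang.NExangulated.exists_isDualizing_of_essential hQ hfin hδ' h₁ h₂⟩
  tfae_have 4 → 3 := fun ⟨A, δ, X, h⟩ =>
    ⟨A, X.X 1, X.dFirst, NExang.NExangulated.Distinguished.inflation h.distinguished,
      h.isIntrinsicWeakCokernel hn hloc, A, h.leftDetermined⟩
  tfae_have 3 → 4 := fun ⟨_, _, _, _, hα, _, hK⟩ =>
    (hα.hasPushEssential hn hKS hfin hloc hK).exists_isAuslanderReiten hKS hn hloc
  tfae_have 4 → 5 := fun ⟨A, δ, X, h⟩ =>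
    ⟨X.X n, C, X.dLast, NExang.NExangulated.Distinguished.deflation h.distinguished, h.right.1,
      h.rightDetermined⟩
  tfae_have 5 → 4 := fun ⟨_, _, _, hα, hs, hd⟩ =>
    (NExang.NExangulated.hasPushEssential_of_rightDetermined hn hfin hloc hα hs
      hd).exists_isAuslanderReiten hKS hn hloc
  tfae_have 4 → 6 := fun ⟨A, δ, X, h⟩ =>
    ⟨X.X n, C, X.dLast, 𝟙 C, NExang.NExangulated.Distinguished.deflation h.distinguished,
      fun ⟨s, hs⟩ => h.right.1 (IsSplitEpi.mk' ⟨s, hs⟩), fun T g hg => by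
        rw [Category.comp_id]
        exact h.right.2 g (hg.not_isSplitEpi NExang.not_isZero_of_isLocalRing)⟩
  tfae_have 6 → 4 := fun ⟨_, _, _, _, hα, hf⟩ =>
    (NExang.NExangulated.hasPushEssential_of_almostFactorsThrough hn hloc hα
      hf).exists_isAuslanderReiten hKS hn hloc
  tfae_finish
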